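/- Fix $1\le k\le\infty$. A \emph{manifold} is a $C^k$ manifold without boundary, locally modelled on spaces $\mathbb{R}^n$ (the dimension $n$ may vary); no separation or countability assumption is made. A \emph{vector bundle} over $M$ is a real vector bundle $E$ of locally finite rank and of some class $C^l$ with $1\le l\le k$. A \emph{connection} on $E$ is a morphism of sheaves of abelian groups $\nabla\colon C^1(E)\to C^0(T^\vee(M)\otimes E)$ with $\nabla_U(fs)=df\otimes s+f\,\nabla_U(s)$ for all open $U\subset M$, $f\in C^1(U)$, $s\in C^1(U,E)$; a section $s\in C^1(U,E)$ is \emph{parallel} if $\nabla_U(s)=0$. Let $H_d=\{x\in\mathbb{R}^d\mid x_d\ge 0\}$ for $d>0$ and $H_0=\mathbb{R}^0$. A subset $F\subset M$ is a \emph{$C^1$ submanifold with boundary} if for every $p\in F$ there are $d,c\in\mathbb{N}$, an open neighbourhood $U$ of $p$ in $M$, and a $C^1$ diffeomorphism $\phi$ from $U$ onto an open subset $V$ of $\mathbb{R}^d\times\mathbb{R}^c$ with $\phi(F\cap U)=(H_d\times\{0\})\cap V$; then $\operatorname{codim}_p(F,M)=c$, and $\operatorname{codim}(F,M)=\inf_{p\in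 F}\operatorname{codim}_p(F,M)$, which is $\infty$ for $F=\emptyset$. Let $\partial F$ be the set of points $p\in F$ that have an open neighbourhood in $F$ which is homeomorphic to $H_d$ for some $d$, by a homeomorphism taking $p$ into the topological boundary of $H_d$ in $\mathbb{R}^d$. \textbf{Theorem.} Let $M$ be a manifold and $F\subset M$ a closed $C^1$ submanifold with boundary such that $\operatorname{codim}(F,M)\ge 1$ and such that every connected component $F'$ of $F$ with $\operatorname{codim}(F',M)=1$ satisfies $F'\cap\partial F\ne\emptyset$. Then $F$ is negligible in $M$ for all connections of class $C^0$: for every vector bundle $E$ over $M$, every connection $\nabla$ on $E$, and every parallel section $s$ of $E$ over $M\setminus F$, there is a parallel section $\tilde s$ of $E$ over $M$ with $\tilde s|_{M\setminus F}=s$. -/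

import Mathlib

open Set TopologicalSpace

universe u w

/-!
Differentiable manifolds in the generality needed here: of class `C^k` with `1 ≤ k ≤ ∞`, modelled
on spaces `ℝⁿ` whose dimension `n` may vary from point to point, without any separation or
countability assumption.  The space `ℝⁿ` is `Fin n → ℝ`; only its topology and its notion of
`C^m` map are used, neither of which depends on the choice of a norm.
-/

/-- The half-space `{x ∈ ℝᵈ | 0 ≤ x_d}` for `0 < d`, and all of `ℝ⁰` for `d = 0`. -/
def halfSpace (d : ℕ) : Set (Fin d → ℝ) :=
  {x | ∀ i : Fin d, (i : ℕ) + 1 = d → 0 ≤ x i}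

/-- The set of boundary points (in the manifold sense) of a topological space `F`: the points that
have an open neighbourhood homeomorphic to some `H_d`, by a homeomorphism that takes the point into
the topological boundary of `H_d` in `ℝᵈ`. -/
def boundaryPoints (F : Type*) [TopologicalSpace F] : Set F :=
  {p | ∃ (d : ℕ) (U : Opens F) (hp : p ∈ U) (φ : U ≃ₜ halfSpace d),
    (φ ⟨p, hp⟩ : Fin d → ℝ) ∈ frontier (halfSpace d)}

/-- A `C^k` manifold structure on the topological space `M`, given by an atlas. The atlas need not
be maximal. -/
structure CkManifold (k : ℕ∞) (M : Type u) [TopologicalSpace M] where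
  /-- The charts, each with its dimension. -/
  atlas : Set (Σ n : ℕ, OpenPartialHomeomorph M (Fin n → ℝ))
  cover : ∀ p : M, ∃ e ∈ atlas, p ∈ e.2.source
  compatible : ∀ e ∈ atlas, ∀ e' ∈ atlas,
    ContDiffOn ℝ k (e'.2 ∘ e.2.symm) (e.2.target ∩ e.2.symm ⁻¹' e'.2.source)

namespace CkManifold

variable {k : ℕ∞} {M : Type u} [TopologicalSpace M] (X : CkManifold k M)

/-- `f` is of class `C^m` on the open set `U` (only the values of `f` on `U` matter). -/
def CmOn (m : ℕ∞) {V : Type*} [NormedAddCommGroup V] [NormedSpace ℝ V] (f : M → V)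
    (U : Set M) : Prop :=
  ∀ e ∈ X.atlas, ContDiffOn ℝ m (f ∘ e.2.symm) (e.2.target ∩ e.2.symm ⁻¹' U)

/-- The charts around `p`. -/
abbrev ChartAt (p : M) : Type u :=
  {e : Σ n : ℕ, OpenPartialHomeomorph M (Fin n → ℝ) // e ∈ X.atlas ∧ p ∈ e.2.source}

/-- The tangent space at `p`: families of vectors, one for each chart around `p`, that are
transformed into each other by the derivatives of the coordinate changes. -/
def TangentAt (p : M) : Submodule ℝ (∀ e : X.ChartAt p, Fin e.1.1 → ℝ) where
  carrier := {v | ∀ e e' : X.ChartAt p,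
    fderiv ℝ (e'.1.2 ∘ e.1.2.symm) (e.1.2 p) (v e) = v e'}
  add_mem' := by
    intro v v' hv hv' e e'
    simp only [mem_ofPred_eq, Pi.add_apply, map_add] at *
    rw [hv, hv']
  zero_mem' := by
    intro e e'
    simp
  smul_mem' := by
    intro a v hv e e'
    simp only [mem_ofPred_eq, Pi.smul_apply, map_smul] at *
    rw [hv]

/-- The differential of `f` at `p`, as a linear form on the tangent space, computed in the chart
`e` around `p`. For `f` of class `C^1` near `p` it does not depend on `e`. -/
noncomputable def differential (f : M → ℝ) {p : M} (e : X.ChartAt p) : X.TangentAt p →ₗ[ℝ] ℝ :=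
  (fderiv ℝ (f ∘ e.1.2.symm) (e.1.2 p)).toLinearMap ∘ₗ
    LinearMap.proj e ∘ₗ (X.TangentAt p).subtype

/-- `φ` is an isomorphism of class `C^m` from an open subset of `M` onto an open subset of `W`. -/
def IsCmIso (m : ℕ∞) {W : Type*} [NormedAddCommGroup W] [NormedSpace ℝ W]
    (φ : OpenPartialHomeomorph M W) : Prop :=
  ∀ e ∈ X.atlas,
    ContDiffOn ℝ m (φ ∘ e.2.symm) (e.2.target ∩ e.2.symm ⁻¹' φ.source) ∧
    ContDiffOn ℝ m (e.2 ∘ φ.symm) (φ.target ∩ φ.symm ⁻¹' e.2.source)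

/-- `F` is a `C^m` submanifold with boundary of `M` at `p`, of codimension `c` at `p`. -/
def HasCodimAt (m : ℕ∞) (F : Set M) (p : M) (c : ℕ) : Prop :=
  ∃ (d : ℕ) (φ : OpenPartialHomeomorph M ((Fin d → ℝ) × (Fin c → ℝ))),
    p ∈ φ.source ∧ X.IsCmIso m φ ∧
      φ '' (F ∩ φ.source) = (halfSpace d ×ˢ {0}) ∩ φ.target

/-- `F` is a `C^m` submanifold with boundary of `M`. -/
def IsSubmanifoldWithBoundary (m : ℕ∞) (F : Set M) : Prop :=
  ∀ p ∈ F, ∃ c : ℕ, X.HasCodimAt m F p c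

/-- The codimension of a `C^m` submanifold with boundary: the infimum of its codimensions at its
points, which is `∞` for the empty set. -/
noncomputable def codim (m : ℕ∞) (F : Set M) : ℕ∞ :=
  sInf {n : ℕ∞ | ∃ p ∈ F, ∃ c : ℕ, X.HasCodimAt m F p c ∧ n = c}

end CkManifold

section Bundles

variable {k : ℕ∞} {M : Type u} [TopologicalSpace M]

/-- A local trivialization, over an open set and with a finite rank, of a family of real vector
spaces over `M`. -/
structure LocalTriv {M : Type u} [TopologicalSpace M] (E : M → Type w)
    [∀ p, AddCommGroup (E p)] [∀ p, Module ℝ (E p)] where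
  rank : ℕ
  base : Opens M
  equiv : ∀ p : base, E p ≃ₗ[ℝ] (Fin rank → ℝ)

variable {E : M → Type w} [∀ p, AddCommGroup (E p)] [∀ p, Module ℝ (E p)]

namespace LocalTriv

open Classical in
/-- The coordinates of a section `s` over `U` in the trivialization `t`. They are meaningful on
`U ∩ t.base`, and are set to `0` elsewhere. -/
noncomputable def coord (t : LocalTriv E) {U : Opens M} (s : ∀ p : U, E p) :
    M → (Fin t.rank → ℝ) :=
  fun p => if h : p ∈ U ∧ p ∈ t.base then t.equiv ⟨p, h.2⟩ (s ⟨p, h.1⟩) else 0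

/-- The section over `t.base` with constant coordinates `x` in the trivialization `t`. -/
def constSection (t : LocalTriv E) (x : Fin t.rank → ℝ) : ∀ p : t.base, E p :=
  fun p => (t.equiv p).symm x

theorem coord_of_mem (t : LocalTriv E) {U : Opens M} (s : ∀ p : U, E p) {p : M} (hU : p ∈ U)
    (ht : p ∈ t.base) : t.coord s p = t.equiv ⟨p, ht⟩ (s ⟨p, hU⟩) := by
  simp [coord, hU, ht]

end LocalTriv

/-- The structure of a real vector bundle of class `C^l` and of locally finite rank on the family
`E` of vector spaces over `M`: a covering by local trivializations whose transition functions are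
of class `C^l`. (The topology and the manifold structure of the total space are the ones for which
these trivializations are isomorphisms.) -/
structure ClVectorBundle (X : CkManifold k M) (l : ℕ∞) (E : M → Type w)
    [∀ p, AddCommGroup (E p)] [∀ p, Module ℝ (E p)] where
  trivs : Set (LocalTriv E)
  cover : ∀ p : M, ∃ t ∈ trivs, p ∈ t.base
  compatible : ∀ t ∈ trivs, ∀ t' ∈ trivs, ∀ x : Fin t.rank → ℝ,
    X.CmOn l (t'.coord (t.constSection x)) (t.base ∩ t'.base)

/-- Restriction of a section over `U` to a smaller open set `V`. -/
def restrictSection {U V : Opens M} (h : V ≤ U) (s : ∀ p : U, E p) : ∀ p : V, E p :=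
  fun p => s ⟨p, h p.2⟩

namespace ClVectorBundle

variable {X : CkManifold k M} {l : ℕ∞} (B : ClVectorBundle X l E)

/-- The group `C^m(U, E)` of sections of class `C^m` over `U`. -/
def sections (m : ℕ∞) (U : Opens M) : AddSubgroup (∀ p : U, E p) where
  carrier := {s | ∀ t ∈ B.trivs, X.CmOn m (t.coord s) (U ∩ t.base)}
  add_mem' := by
    intro s s' hs hs' t ht e he
    refine ((hs t ht e he).add (hs' t ht e he)).congr ?_
    rintro y ⟨-, hU, hb⟩
    simp [LocalTriv.coord_of_mem t _ hU hb]
  zero_mem' := by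
    intro t ht e he
    refine (contDiffOn_const (c := (0 : Fin t.rank → ℝ))).congr ?_
    rintro y ⟨-, hU, hb⟩
    simp [LocalTriv.coord_of_mem t _ hU hb]
  neg_mem' := by
    intro s hs t ht e he
    refine (hs t ht e he).neg.congr ?_
    rintro y ⟨-, hU, hb⟩
    simp [LocalTriv.coord_of_mem t _ hU hb]

/-- Restriction `C^m(U, E) → C^m(V, E)` for `V ⊆ U`. -/
def restrict {m : ℕ∞} {U V : Opens M} (h : V ≤ U) (s : B.sections m U) : B.sections m V :=
  ⟨restrictSection h s.1, by
    intro t ht e he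
    refine ((s.2 t ht e he).mono ?_).congr ?_
    · exact fun y hy => ⟨hy.1, h hy.2.1, hy.2.2⟩
    · rintro y ⟨-, hV, hb⟩
      simp [LocalTriv.coord_of_mem t _ hV hb, LocalTriv.coord_of_mem t _ (h hV) hb,
        restrictSection]⟩

/-- The product of a `C^m` function on `U` with a `C^m` section over `U`. -/
def mulSection {m : ℕ∞} {U : Opens M} (f : M → ℝ) (hf : X.CmOn m f U) (s : B.sections m U) :
    B.sections m U :=
  ⟨fun p => f p • s.1 p, by
    intro t ht e he
    refine (((hf e he).mono ?_).smul (s.2 t ht e he)).congr ?_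
    · exact fun y hy => ⟨hy.1, hy.2.1⟩
    · rintro y ⟨-, hU, hb⟩
      simp [LocalTriv.coord_of_mem t _ hU hb]⟩

/-- The group `C^0(U, T^∨(M) ⊗ E)` of continuous `E`-valued one-forms over `U`, where
`T_p^∨(M) ⊗ E_p` is identified with the space of linear maps from `T_p(M)` to `E_p`. Continuity
means that the matrices representing these linear maps with respect to charts and local
trivializations depend continuously on the point. -/
def forms (U : Opens M) : AddSubgroup (∀ p : U, X.TangentAt (p : M) →ₗ[ℝ] E p) where
  carrier := {ξ | ∀ t ∈ B.trivs, ∀ e : Σ n : ℕ, OpenPartialHomeomorph M (Fin n → ℝ),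
    ∀ he : e ∈ X.atlas, ∃ A : M → ((Fin e.1 → ℝ) →L[ℝ] (Fin t.rank → ℝ)),
      ContinuousOn A (U ∩ t.base ∩ e.2.source) ∧
      ∀ (p : M) (hU : p ∈ U) (hb : p ∈ t.base) (hp : p ∈ e.2.source) (v : X.TangentAt p),
        t.equiv ⟨p, hb⟩ (ξ ⟨p, hU⟩ v) = A p (v.1 ⟨e, he, hp⟩)}
  add_mem' := by
    intro ξ ξ' h h' t ht e he
    obtain ⟨A, hA, hA'⟩ := h t ht e he
    obtain ⟨B', hB, hB'⟩ := h' t ht e he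
    refine ⟨fun p => A p + B' p, hA.add hB, fun p hU hb hp v => ?_⟩
    simp [hA' p hU hb hp v, hB' p hU hb hp v]
  zero_mem' := by
    intro t ht e he
    exact ⟨fun _ => 0, continuousOn_const, fun p hU hb hp v => by simp⟩
  neg_mem' := by
    intro ξ h t ht e he
    obtain ⟨A, hA, hA'⟩ := h t ht e he
    refine ⟨fun p => -A p, hA.neg, fun p hU hb hp v => ?_⟩
    simp [hA' p hU hb hp v]

/-- A connection (of class `C^0`): a morphism of abelian sheaves `C^1(E) → C^0(T^∨(M) ⊗ E)` that
satisfies the Leibniz rule `∇(fs) = df ⊗ s + f∇s`. -/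
structure Connection where
  toHom : ∀ U : Opens M, B.sections 1 U →+ B.forms U
  map_restrict : ∀ (U V : Opens M) (h : V ≤ U) (s : B.sections 1 U) (p : V),
    (toHom V (B.restrict h s)).1 p = (toHom U s).1 ⟨p, h p.2⟩
  leibniz : ∀ (U : Opens M) (f : M → ℝ) (hf : X.CmOn 1 f U) (s : B.sections 1 U) (p : U)
    (e : X.ChartAt (p : M)),
    (toHom U (B.mulSection f hf s)).1 p =
      (X.differential f e).smulRight (s.1 p) + f p • (toHom U s).1 p

namespace Connection

variable {B}

/-- The group `Γ^∇(U, E)` of `∇`-parallel sections over `U`. -/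
def parallelSections (D : B.Connection) (U : Opens M) : AddSubgroup (B.sections 1 U) :=
  (D.toHom U).ker

/-- The closed set `F` is negligible in `M` for the vector bundle with connection: every parallel
section over `M ∖ F` is the restriction of a parallel section over `M`. -/
def IsNegligible (D : B.Connection) (F : Closeds M) : Prop :=
  ∀ s ∈ D.parallelSections F.compl, ∃ s' ∈ D.parallelSections ⊤, B.restrict le_top s' = s

end Connection

end ClVectorBundle

/-- The closed set `F` is negligible in `M` for all connections of class `C^0`, on all vector
bundles over `M` of any class `C^l` with `1 ≤ l ≤ k`. -/
def IsNegligibleForAllConnections (X : CkManifold k M) (F : Closeds M) : Prop :=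
  ∀ (l : ℕ∞), 1 ≤ l → l ≤ k →
    ∀ (E : M → Type w) [∀ p, AddCommGroup (E p)] [∀ p, Module ℝ (E p)]
      (B : ClVectorBundle X l E) (D : B.Connection), D.IsNegligible F

end Bundles

/-!
Parallel sections are the solutions of a total differential equation `du = Γ(u)` with continuous
`Γ`, linear in `u`; this is `exists_christoffel` and `exists_parallelSection_of_hasFDerivAt`. By
Grönwall's inequality along segments, a solution on a bounded convex open set is Lipschitz, so it
extends continuously to the closure, and the extension is still a solution.

Locally `F` lies in a hypersurface, the zero set of one normal coordinate. A parallel section over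
the complement of `F` extends from either side up to this hypersurface, and the difference of the
two extensions solves the equation along the hypersurface. So if the two extensions agree at one
point, then they agree nearby and the section extends (`exists_extension_across_hyperplane`,
`exists_ball_forall_extendsAt`). They do agree at points of the hypersurface outside `F`. Such
points exist near every point of `F` where the codimension is at least `2`, and near every point
that a submanifold chart takes into the boundary of the half-space. Hence the set of points of `F`
near which the section extends is open and closed in `F`, and a component of `F` that it misses
consists of interior points of codimension `1` (`exists_open_not_extendsAt`).

By hypothesis such a component contains a point of `∂F`, which is defined by homeomorphisms only. It
remains to see that a point with a Euclidean neighbourhood in `F` is not in `∂F`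
(`notMem_boundaryPoints_of_mem_source`). A half-space can be pushed off its boundary by arbitrarily
small displacements, so that near a boundary point there are continuous maps close to the identity
that miss this point. In a Euclidean neighbourhood this contradicts Brouwer's theorem
(`exists_eq_zero_of_dist_self_lt`), which is proved by the method of Milnor and Rogers: for a `C¹`
retraction `r` of the ball onto the sphere, the integral over the ball of the Jacobian of
`x + t (r x - x)` is a polynomial in `t`, equal to the volume of the ball for small `t` and to `0`
for `t = 1`.
-/

open Filter Topology MeasureTheory Metric

/-! ### Brouwer's theorem -/

/-- A map that is Lipschitz on a closed set and vanishes outside its interior is Lipschitz: a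
segment leaving the set crosses the frontier. -/
theorem LipschitzOnWith.lipschitzWith_of_eq_zero {E F : Type*} [NormedAddCommGroup E]
    [NormedSpace ℝ E] [NormedAddCommGroup F] {g : E → F} {s : Set E} (hs : IsClosed s)
    {K : NNReal} (hg : LipschitzOnWith K g s) (h0 : ∀ x ∉ interior s, g x = 0) :
    LipschitzWith K g := by
  have key : ∀ x ∈ s, ∀ y ∉ s, dist (g x) (g y) ≤ K * dist x y := by
    intro x hx y hy
    obtain ⟨z, hz, hzf⟩ : ((segment ℝ x y) ∩ frontier s).Nonempty := by
      by_contra hemp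
      have hnf : ∀ z ∈ segment ℝ x y, z ∉ frontier s := fun z hz hzf => hemp ⟨z, hz, hzf⟩
      have hint : ∀ z ∈ segment ℝ x y, z ∈ s → z ∈ interior s := fun z hz hzs => by
        by_contra hzi
        exact hnf z hz (hs.frontier_eq ▸ ⟨hzs, hzi⟩)
      obtain ⟨z, -, hz1, hz2⟩ := (convex_segment x y).isPreconnected (interior s) sᶜ
        isOpen_interior hs.isOpen_compl
        (fun z hz => (em (z ∈ s)).imp (hint z hz) id)
        ⟨x, left_mem_segment ℝ x y, hint x (left_mem_segment ℝ x y) hx⟩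
        ⟨y, right_mem_segment ℝ x y, hy⟩
      exact hz2 (interior_subset hz1)
    have hz0 : g z = 0 := h0 z hzf.2
    have hy0 : g y = 0 := h0 y fun h => hy (interior_subset h)
    calc dist (g x) (g y) = dist (g x) (g z) := by rw [hz0, hy0]
      _ ≤ K * dist x z := hg.dist_le_mul x hx z (hs.frontier_subset hzf)
      _ ≤ K * dist x y := by
        gcongr
        rw [← dist_add_dist_of_mem_segment hz]
        linarith [dist_nonneg (x := z) (y := y)]
  refine LipschitzWith.of_dist_le_mul fun x y => ?_
  by_cases hx : x ∈ s <;> by_cases hy : y ∈ s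
  · exact hg.dist_le_mul x hx y hy
  · exact key x hx y hy
  · rw [dist_comm, dist_comm x]; exact key y hy x hx
  · rw [h0 x fun h => hx (interior_subset h), h0 y fun h => hy (interior_subset h), dist_self]
    positivity

/-- Lagrange interpolation: the value at `1` of the polynomial `t ↦ det (1 + t A)` is an affine
combination of its values at `dim E + 1` arbitrary distinct points, with weights that do not depend
on `A`. -/
theorem exists_weights_det_one_add {E : Type*} [NormedAddCommGroup E] [NormedSpace ℝ E]
    [FiniteDimensional ℝ E] (v : ℕ → ℝ) (hv : Function.Injective v) :
    ∃ w : ℕ → ℝ, ∑ i ∈ Finset.range (Module.finrank ℝ E + 1), w i = 1 ∧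
      ∀ A : E →L[ℝ] E, (1 + A).det =
        ∑ i ∈ Finset.range (Module.finrank ℝ E + 1), w i * (1 + v i • A).det := by
  classical
  set n := Module.finrank ℝ E
  set s := Finset.range (n + 1)
  refine ⟨fun i => (Lagrange.basis s v i).eval 1, ?_, fun A => ?_⟩
  · rw [← Polynomial.eval_finsetSum, Lagrange.sum_basis hv.injOn (by simp [s])]
    simp
  · let b := Module.finBasis ℝ E
    let Am := LinearMap.toMatrix b b (A : E →ₗ[ℝ] E)
    let p : Polynomial ℝ := Matrix.det
      ((Polynomial.X : Polynomial ℝ) • Am.map Polynomial.C +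
        (1 : Matrix (Fin n) (Fin n) ℝ).map Polynomial.C)
    have hp : ∀ t, p.eval t = (1 + t • A).det := by
      intro t
      have : (1 + t • A).det = Matrix.det (1 + t • Am) := by
        rw [ContinuousLinearMap.det, ← LinearMap.det_toMatrix b]
        congr 1
        simp only [ContinuousLinearMap.toLinearMap_add, ContinuousLinearMap.toLinearMap_smul,
          map_add, map_smul, Am]
        congr 1
        exact LinearMap.toMatrix_one b
      rw [this, ← Polynomial.coe_evalRingHom, RingHom.map_det]
      congr 1
      ext i j
      by_cases hij : i = j <;> simp [hij, add_comm, mul_comm t]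
    have hdeg : p.degree < s.card := by
      have := Polynomial.natDegree_det_X_add_C_le Am 1
      simp only [Fintype.card_fin] at this
      refine lt_of_le_of_lt Polynomial.degree_le_natDegree ?_
      simp only [s, Finset.card_range]
      exact_mod_cast Nat.lt_succ_of_le this
    have h1 := hp 1
    rw [one_smul] at h1
    rw [← h1, Lagrange.eq_interpolate hv.injOn hdeg, Lagrange.interpolate_apply,
      Polynomial.eval_finsetSum]
    refine Finset.sum_congr rfl fun i _ => ?_
    rw [Polynomial.eval_mul, Polynomial.eval_C, ← hp, mul_comm,
      Lagrange.eq_interpolate hv.injOn hdeg]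

section Retraction
variable {E : Type*} [NormedAddCommGroup E] [InnerProductSpace ℝ E] [FiniteDimensional ℝ E]

/-- For small `t`, the map `x ↦ x + t (r x - x)` is a bijection of the ball with positive Jacobian,
so that its Jacobian integrates to the volume of the ball. -/
theorem eventually_integral_det_eq [MeasurableSpace E] [BorelSpace E] {r : E → E}
    (hr : ContDiff ℝ 1 r) (hB : ∀ x ∈ closedBall (0 : E) 1, r x ∈ closedBall (0 : E) 1)
    (hS : ∀ x ∈ sphere (0 : E) 1, r x = x) :
    ∀ᶠ t : ℝ in 𝓝[>] 0, ∫ x in closedBall (0 : E) 1, (1 + t • (fderiv ℝ r x - 1)).det =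
      volume.real (closedBall (0 : E) 1) := by
  classical
  have hconv := convex_closedBall (0 : E) 1
  have hcpt := isCompact_closedBall (0 : E) 1
  set g : E → E := fun x => r x - x with hg
  have hgd : ∀ x, HasFDerivAt g (fderiv ℝ r x - 1) x := fun x =>
    ((hr.differentiable (by norm_num)) x).hasFDerivAt.sub (hasFDerivAt_id x)
  have hcont : Continuous fun x => fderiv ℝ r x - (1 : E →L[ℝ] E) :=
    (hr.continuous_fderiv (by norm_num)).sub continuous_const
  obtain ⟨C, hC⟩ := hcpt.exists_bound_of_continuousOn hcont.continuousOn
  set K : NNReal := Real.toNNReal C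
  have hK : ∀ x ∈ closedBall (0 : E) 1, ‖fderiv ℝ r x - (1 : E →L[ℝ] E)‖₊ ≤ K := fun x hx => by
    rw [← NNReal.coe_le_coe, coe_nnnorm]
    exact (hC x hx).trans (Real.le_coe_toNNReal C)
  have hLip : LipschitzOnWith K g (closedBall 0 1) :=
    hconv.lipschitzOnWith_of_nnnorm_hasFDerivWithin_le
      (fun x _ => (hgd x).hasFDerivWithinAt) hK
  -- extended by `0`, the map `r - id` stays Lipschitz, so `id + t (r - id)` is bijective on `E`
  set G : E → E := (closedBall (0 : E) 1).indicator g with hG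
  have hGL : LipschitzWith K G := by
    refine LipschitzOnWith.lipschitzWith_of_eq_zero isClosed_closedBall
      (s := closedBall (0 : E) 1) ?_ fun x hx => ?_
    · intro x hx y hy
      simpa [G, indicator_of_mem hx, indicator_of_mem hy] using hLip hx hy
    · by_cases hx' : x ∈ closedBall (0 : E) 1
      · simp only [G, indicator_of_mem hx', g, sub_eq_zero]
        refine hS x ?_
        have h1 : x ∉ ball (0 : E) 1 := fun h => hx (ball_subset_interior_closedBall h)
        simp only [mem_closedBall, mem_ball, mem_sphere, not_lt] at *
        exact le_antisymm hx' h1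
      · exact indicator_of_notMem hx' _
  have hdet : ∀ᶠ A : E →L[ℝ] E in 𝓝 1, 0 < A.det := by
    refine (ContinuousLinearMap.continuous_det.tendsto (1 : E →L[ℝ] E)).eventually_const_lt ?_
    rw [ContinuousLinearMap.det]
    simp
  obtain ⟨δ, hδ, hdet⟩ := Metric.eventually_nhds_iff.1 hdet
  have e1 : ∀ᶠ t : ℝ in 𝓝[>] 0, t * (K + 1) < min δ 1 := by
    refine nhdsWithin_le_nhds ?_
    have : Tendsto (fun t : ℝ => t * (K + 1)) (𝓝 0) (𝓝 (0 * (K + 1))) :=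
      (continuous_id.mul continuous_const).tendsto _
    rw [zero_mul] at this
    exact this.eventually_lt_const (lt_min hδ one_pos)
  filter_upwards [e1, self_mem_nhdsWithin] with t ht (ht0 : 0 < t)
  have htδ : t * K < δ := by nlinarith [min_le_left δ 1]
  have ht1 : t * K < 1 := by nlinarith [min_le_right δ 1]
  have htl : t ≤ 1 := by nlinarith [min_le_right δ 1, K.2]
  have hK1 : t.toNNReal * K < 1 := by
    rw [← NNReal.coe_lt_coe]
    simpa [Real.coe_toNNReal _ ht0.le] using ht1
  set f : E → E := fun x => x + t • G x with hf
  have happ : ApproximatesLinearOn f ((ContinuousLinearEquiv.refl ℝ E : E ≃L[ℝ] E) : E →L[ℝ] E)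
      univ (t.toNNReal * K) := by
    rw [ApproximatesLinearOn.approximatesLinearOn_iff_lipschitzOnWith, lipschitzOnWith_univ]
    refine LipschitzWith.of_dist_le_mul fun x y => ?_
    have := hGL.dist_le_mul x y
    simp only [hf, Pi.sub_apply, ContinuousLinearEquiv.coe_refl, ContinuousLinearMap.coe_id', id,
      add_sub_cancel_left, NNReal.coe_mul, Real.coe_toNNReal _ ht0.le, dist_smul₀,
      Real.norm_eq_abs, abs_of_pos ht0]
    rw [mul_assoc]
    gcongr
  have hc : Subsingleton E ∨ t.toNNReal * K <
      ‖((ContinuousLinearEquiv.refl ℝ E).symm : E →L[ℝ] E)‖₊⁻¹ := by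
    rcases subsingleton_or_nontrivial E with h | h
    · exact Or.inl h
    · right
      have : ‖((ContinuousLinearEquiv.refl ℝ E).symm : E →L[ℝ] E)‖₊ = 1 := by
        rw [← NNReal.coe_inj, coe_nnnorm]
        exact ContinuousLinearMap.norm_id
      rw [this]
      simpa using hK1
  have hinj : Function.Injective f := injOn_univ.1 (happ.injOn hc)
  have hsurj : Function.Surjective f := happ.surjective hc
  have hin : ∀ x ∈ closedBall (0 : E) 1, f x = x + t • (r x - x) := fun x hx => by
    simp [hf, G, indicator_of_mem hx, hg]
  have hout : ∀ x ∉ closedBall (0 : E) 1, f x = x := fun x hx => by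
    simp [hf, G, indicator_of_notMem hx]
  have himg : f '' closedBall (0 : E) 1 = closedBall 0 1 := by
    apply Subset.antisymm
    · rintro _ ⟨x, hx, rfl⟩
      rw [hin x hx]
      have := hconv hx (hB x hx) (sub_nonneg.2 htl) ht0.le (by ring)
      convert this using 1
      module
    · intro y hy
      obtain ⟨x, rfl⟩ := hsurj y
      by_contra hx
      have hx' : x ∉ closedBall (0 : E) 1 := fun h => hx ⟨x, h, rfl⟩
      exact hx' (by rwa [hout x hx'] at hy)
  have hder : ∀ x ∈ closedBall (0 : E) 1,
      HasFDerivWithinAt f (1 + t • (fderiv ℝ r x - 1)) (closedBall 0 1) x := by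
    intro x hx
    refine HasFDerivWithinAt.congr ?_ hin (hin x hx)
    exact ((hasFDerivAt_id x).add ((hgd x).const_smul t)).hasFDerivWithinAt
  have hvol := lintegral_abs_det_fderiv_eq_addHaar_image volume
    measurableSet_closedBall hder hinj.injOn
  have hpos : ∀ x ∈ closedBall (0 : E) 1, 0 < (1 + t • (fderiv ℝ r x - 1)).det := by
    intro x hx
    apply hdet
    rw [dist_eq_norm, add_sub_cancel_left, norm_smul, Real.norm_eq_abs, abs_of_pos ht0]
    refine lt_of_le_of_lt ?_ htδ
    gcongr
    exact_mod_cast hK x hx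
  rw [himg] at hvol
  rw [integral_eq_lintegral_of_nonneg_ae, Measure.real, ← hvol]
  · congr 1
    refine setLIntegral_congr_fun measurableSet_closedBall fun x hx => ?_
    simp only [abs_of_pos (hpos x hx)]
  · filter_upwards [ae_restrict_mem measurableSet_closedBall] with x hx using (hpos x hx).le
  · exact (ContinuousLinearMap.continuous_det.comp
      (continuous_const.add (hcont.const_smul t))).aestronglyMeasurable

/-- There is no `C¹` retraction of the closed unit ball onto the unit sphere. -/
theorem not_exists_contDiff_retraction_sphere {r : E → E}
    (hr : ContDiff ℝ 1 r) (hB : ∀ x, ‖r x‖ = 1)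
    (hS : ∀ x ∈ sphere (0 : E) 1, r x = x) : False := by
  borelize E
  have hev := eventually_integral_det_eq hr (fun x _ => by simp [hB x]) hS
  obtain ⟨δ, hδ, hδ'⟩ := mem_nhdsGT_iff_exists_Ioo_subset.1 hev
  simp only [mem_Ioi] at hδ
  -- distinct points of `(0, δ)`
  set v : ℕ → ℝ := fun i => δ / (i + 2) with hv
  have hvinj : Function.Injective v := by
    intro i j hij
    simp only [hv] at hij
    rw [div_eq_div_iff (by positivity) (by positivity)] at hij
    have := mul_left_cancel₀ hδ.ne' hij
    have h2 : (j : ℝ) = i := by linarith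
    exact_mod_cast h2.symm
  have hvmem : ∀ i, v i ∈ Ioo 0 δ := fun i =>
    ⟨by positivity, div_lt_self hδ (by have : (0 : ℝ) ≤ i := by positivity
                                       linarith)⟩
  obtain ⟨w, hw1, hw⟩ := exists_weights_det_one_add (E := E) v hvinj
  have hcont : Continuous fun x => fderiv ℝ r x - (1 : E →L[ℝ] E) :=
    (hr.continuous_fderiv (by norm_num)).sub continuous_const
  -- the values of `r` have norm `1`, so its derivative at `x` is never onto: it misses `r x`
  have hzero : ∀ x, (1 + (fderiv ℝ r x - 1)).det = 0 := by
    intro x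
    rw [add_sub_cancel]
    have hd : HasFDerivAt r (fderiv ℝ r x) x :=
      ((hr.differentiable (by norm_num)) x).hasFDerivAt
    have h1 := hd.norm_sq
    have h2 : (fun y => ‖r y‖ ^ 2) = fun _ => (1 : ℝ) := funext fun y => by rw [hB y, one_pow]
    rw [h2] at h1
    have h3 := h1.unique (hasFDerivAt_const (1 : ℝ) x)
    by_contra hne
    have hunit : IsUnit (LinearMap.det (fderiv ℝ r x : E →ₗ[ℝ] E)) := isUnit_iff_ne_zero.2 hne
    obtain ⟨y, hy⟩ := ((LinearMap.equivOfDetNeZero _ hne).surjective (r x))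
    have hy' : fderiv ℝ r x y = r x := hy
    have h4 := DFunLike.congr_fun h3 y
    have h5 : 2 • inner ℝ (r x) (fderiv ℝ r x y) = 0 := h4
    rw [hy', real_inner_self_eq_norm_sq, hB x] at h5
    norm_num at h5
  have hint : ∀ t : ℝ, IntegrableOn (fun x => (1 + t • (fderiv ℝ r x - 1)).det)
      (closedBall (0 : E) 1) := fun t =>
    ((ContinuousLinearMap.continuous_det.comp
      (continuous_const.add (hcont.const_smul t))).continuousOn).integrableOn_compact
      (isCompact_closedBall _ _)
  have hfin : ∫ x in closedBall (0 : E) 1, (1 + (fderiv ℝ r x - 1)).det =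
      volume.real (closedBall (0 : E) 1) := by
    rw [funext fun x => hw (fderiv ℝ r x - 1)]
    rw [integral_finsetSum _ fun i _ => (hint (v i)).const_mul _]
    simp_rw [integral_const_mul]
    rw [Finset.sum_congr rfl fun i _ => by rw [show _ = _ from hδ' (hvmem i)], ← Finset.sum_mul,
      hw1, one_mul]
  simp_rw [hzero] at hfin
  simp only [integral_zero] at hfin
  have : 0 < volume.real (closedBall (0 : E) 1) :=
    ENNReal.toReal_pos (measure_closedBall_pos _ _ one_pos).ne'
      measure_closedBall_lt_top.ne
  exact this.ne hfin

/-- **Brouwer's theorem**, in the following form: a continuous map of a closed ball that moves all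
points by less than half of the radius hits the centre. If it did not, it could be interpolated with
the identity near the sphere, smoothed and normalized to a retraction onto the sphere. -/
theorem exists_eq_zero_of_dist_self_lt {g : E → E} (hg : ContinuousOn g (closedBall 0 1))
    (hclose : ∀ x ∈ closedBall (0 : E) 1, ‖g x - x‖ < 1 / 2) :
    ∃ x ∈ closedBall (0 : E) 1, g x = 0 := by
  by_contra! hne
  -- a cut-off function, equal to `1` for `‖x‖ ≤ 1 / 2` and to `0` for `‖x‖ ≥ 2 / 3`
  let χ : E → ℝ := fun x => max 0 (min 1 (4 - 6 * ‖x‖))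
  have hχ : Continuous χ := by fun_prop
  have hχ0 : ∀ x, 0 ≤ χ x := fun x => le_max_left _ _
  have hχ1 : ∀ x, χ x ≤ 1 := fun x => max_le zero_le_one (min_le_left _ _)
  have hχin : ∀ x, ‖x‖ ≤ 1 / 2 → χ x = 1 := fun x hx => by
    simp only [χ]
    rw [min_eq_left (by linarith), max_eq_right zero_le_one]
  have hχout : ∀ x, 2 / 3 ≤ ‖x‖ → χ x = 0 := fun x hx => by
    simp only [χ]
    exact max_eq_left ((min_le_right _ _).trans (by linarith))
  let f : E → E := fun x => x + χ x • (g x - x)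
  have hfout : ∀ x, 2 / 3 ≤ ‖x‖ → f x = x := fun x hx => by simp [f, hχout x hx]
  have hfcont : Continuous f := by
    refine continuous_iff_continuousAt.2 fun x => ?_
    rcases lt_or_ge ‖x‖ 1 with hx | hx
    · have : ContinuousAt g x := hg.continuousAt (closedBall_mem_nhds_of_mem (by simpa using hx))
      exact continuousAt_id.add (hχ.continuousAt.smul (this.sub continuousAt_id))
    · have : f =ᶠ[𝓝 x] id := by
        filter_upwards [(isOpen_lt continuous_const continuous_norm).mem_nhds
          (show (2 / 3 : ℝ) < ‖x‖ by linarith)] with y (hy : 2 / 3 < ‖y‖) using hfout y hy.le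
      exact continuousAt_id.congr this.symm
  have hfne : ∀ x, f x ≠ 0 := by
    intro x hx
    rcases le_or_gt ‖x‖ (1 / 2) with h | h
    · refine hne x (by simpa using h.trans (by norm_num)) ?_
      simpa [f, hχin x h] using hx
    · rcases le_or_gt ‖x‖ 1 with h1 | h1
      · have h2 := hclose x (by simpa using h1)
        have h3 : ‖χ x • (g x - x)‖ ≤ ‖g x - x‖ := by
          rw [norm_smul, Real.norm_eq_abs, abs_of_nonneg (hχ0 x)]
          exact mul_le_of_le_one_left (norm_nonneg _) (hχ1 x)
        have h4 : x = -(χ x • (g x - x)) := eq_neg_of_add_eq_zero_left hx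
        have h5 : ‖x‖ = ‖χ x • (g x - x)‖ := by rw [← norm_neg (χ x • (g x - x)), ← h4]
        linarith
      · rw [hfout x (by linarith)] at hx
        simp only [hx, norm_zero] at h1
        linarith
  obtain ⟨h, hC, happ, heq, -⟩ := hfcont.exists_contDiff_approx_and_eqOn 1 hfcont.norm
    (fun x => norm_pos_iff.2 (hfne x)) (S := {x | 1 ≤ ‖x‖}) (U := {x | 2 / 3 < ‖x‖})
    (isClosed_le continuous_const continuous_norm)
    ((isOpen_lt continuous_const continuous_norm).mem_nhdsSet.2 fun x (hx : 1 ≤ ‖x‖) =>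
      show 2 / 3 < ‖x‖ by linarith)
    (contDiffOn_id.congr fun x (hx : 2 / 3 < ‖x‖) => hfout x hx.le)
  have hh : ∀ x, h x ≠ 0 := fun x hx => by simpa [hx] using happ x
  refine not_exists_contDiff_retraction_sphere (r := fun x => ‖h x‖⁻¹ • h x)
    (((hC.norm ℝ hh).inv fun x => norm_ne_zero_iff.2 (hh x)).smul hC) (fun x => ?_) fun x hx => ?_
  · rw [norm_smul, norm_inv, norm_norm, inv_mul_cancel₀ (norm_ne_zero_iff.2 (hh x))]
  · have hx1 : ‖x‖ = 1 := by simpa using hx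
    rw [heq (show 1 ≤ ‖x‖ from hx1.ge), hfout x (by rw [hx1]; norm_num), hx1, inv_one, one_smul]

end Retraction

/-! ### Boundary points and Euclidean neighbourhoods -/

theorem isOpen_pos_lastCoord {d : ℕ} :
    IsOpen {x : Fin d → ℝ | ∀ i : Fin d, (i : ℕ) + 1 = d → 0 < x i} := by
  have : {x : Fin d → ℝ | ∀ i : Fin d, (i : ℕ) + 1 = d → 0 < x i} =
      ⋂ i : Fin d, {x | (i : ℕ) + 1 = d → 0 < x i} := by ext; simp
  rw [this]
  refine isOpen_iInter_of_finite fun i => ?_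
  by_cases hi : (i : ℕ) + 1 = d
  · simpa [hi] using isOpen_lt continuous_const (continuous_apply i)
  · simp [hi]

theorem exists_coord_le_zero_of_mem_frontier_halfSpace {d : ℕ} {y : Fin d → ℝ}
    (hy : y ∈ frontier (halfSpace d)) : ∃ i : Fin d, (i : ℕ) + 1 = d ∧ y i ≤ 0 := by
  by_contra! h
  exact hy.2 (mem_interior.2 ⟨_, fun x hx i hi => (hx i hi).le, isOpen_pos_lastCoord, h⟩)

/-- The translation of the half-space by `|ε|` along all coordinates. For `ε ≠ 0` its image misses
the boundary. -/
def halfSpaceShift {d : ℕ} (ε : ℝ) (y : halfSpace d) : halfSpace d :=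
  ⟨fun i => y.1 i + |ε|, fun i hi => add_nonneg (y.2 i hi) (abs_nonneg ε)⟩

theorem continuous_halfSpaceShift {d : ℕ} :
    Continuous fun z : ℝ × halfSpace d => halfSpaceShift z.1 z.2 :=
  Continuous.subtype_mk (continuous_pi fun i =>
    ((continuous_apply i).comp (continuous_subtype_val.comp continuous_snd)).add
      continuous_fst.abs) _

/-- Invariance of the boundary: a point with a Euclidean neighbourhood is not a boundary point. A
half-space can be pushed off its boundary by an arbitrarily small displacement, whereas by Brouwer's
theorem a small displacement of a ball cannot miss the centre. -/
theorem notMem_boundaryPoints_of_mem_source {F E : Type*} [TopologicalSpace F]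
    [NormedAddCommGroup E] [InnerProductSpace ℝ E] [FiniteDimensional ℝ E]
    (e : OpenPartialHomeomorph F E) {q : F} (hq : q ∈ e.source) : q ∉ boundaryPoints F := by
  classical
  rintro ⟨d, U, hqU, φ, hφ⟩
  obtain ⟨i, hi, hi0⟩ := exists_coord_le_zero_of_mem_frontier_halfSpace hφ
  have hnhds : e.target ∩ e.symm ⁻¹' U ∈ 𝓝 (e q) :=
    (e.symm.isOpen_inter_preimage U.isOpen).mem_nhds ⟨e.map_source hq, by simpa [e.left_inv hq]⟩
  obtain ⟨R, hR, hRsub⟩ := Metric.nhds_basis_closedBall.mem_iff.1 hnhds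
  have hmem : ∀ x : closedBall (0 : E) 1, e q + R • (x : E) ∈ closedBall (e q) R := by
    intro x
    have := mem_closedBall_zero_iff.1 x.2
    rw [mem_closedBall, dist_eq_norm, add_sub_cancel_left, norm_smul, Real.norm_eq_abs,
      abs_of_pos hR]
    exact mul_le_of_le_one_right hR.le this
  let ψ : closedBall (0 : E) 1 → U := fun x => ⟨e.symm (e q + R • (x : E)), (hRsub (hmem x)).2⟩
  have hψ : Continuous ψ := by
    refine Continuous.subtype_mk ?_ _
    exact e.symm.continuousOn.comp_continuous (by fun_prop) fun x => (hRsub (hmem x)).1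
  -- the displacements of the half-space, read in the ball through `φ` and `e`
  let Θ : ℝ × closedBall (0 : E) 1 → F := fun z => (φ.symm (halfSpaceShift z.1 (φ (ψ z.2))) : F)
  have hΘ : Continuous Θ := continuous_subtype_val.comp (φ.symm.continuous.comp
    (continuous_halfSpaceShift.comp
      (continuous_fst.prodMk (φ.continuous.comp (hψ.comp continuous_snd)))))
  have hΘ0 : ∀ x, Θ (0, x) = e.symm (e q + R • (x : E)) := by
    intro x
    have : halfSpaceShift 0 (φ (ψ x)) = φ (ψ x) := Subtype.ext (by simp [halfSpaceShift])
    simp [Θ, this, ψ]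
  have hsrc : ∀ x, Θ (0, x) ∈ e.source := fun x => by
    rw [hΘ0]; exact e.map_target (hRsub (hmem x)).1
  have hev : ∀ x : closedBall (0 : E) 1, x ∈ univ → ∀ᶠ z : ℝ × closedBall (0 : E) 1 in 𝓝 (0, x),
      Θ z ∈ e.source ∧ ‖R⁻¹ • (e (Θ z) - e q) - (z.2 : E)‖ < 1 / 2 := by
    intro x _
    refine (hΘ.continuousAt.eventually (e.open_source.mem_nhds (hsrc x))).and ?_
    have hc : ContinuousAt (fun z : ℝ × closedBall (0 : E) 1 =>
        ‖R⁻¹ • (e (Θ z) - e q) - (z.2 : E)‖) (0, x) := by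
      have : ContinuousAt (fun z => e (Θ z)) (0, x) :=
        ContinuousAt.comp (e.continuousAt (hsrc x)) hΘ.continuousAt
      exact (((this.sub continuousAt_const).const_smul _).sub
        (continuous_subtype_val.comp continuous_snd).continuousAt).norm
    refine hc.eventually_lt_const ?_
    simp only [hΘ0]
    rw [e.right_inv (hRsub (hmem x)).1, add_sub_cancel_left, smul_smul,
      inv_mul_cancel₀ hR.ne', one_smul, sub_self, norm_zero]
    norm_num
  have hunif : ∀ᶠ ε : ℝ in 𝓝[>] 0, ∀ x ∈ (univ : Set (closedBall (0 : E) 1)),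
      Θ (ε, x) ∈ e.source ∧ ‖R⁻¹ • (e (Θ (ε, x)) - e q) - (x : E)‖ < 1 / 2 :=
    nhdsWithin_le_nhds (isCompact_univ.eventually_forall_of_forall_eventually hev)
  obtain ⟨ε, hε, hε0⟩ := (hunif.and self_mem_nhdsWithin).exists
  simp only [mem_univ, true_implies] at hε
  let g : closedBall (0 : E) 1 → E := fun x => R⁻¹ • (e (Θ (ε, x)) - e q)
  have hg : Continuous g := by
    have : Continuous fun x => e (Θ (ε, x)) :=
      e.continuousOn.comp_continuous (hΘ.comp (by fun_prop)) fun x => (hε x).1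
    exact (this.sub continuous_const).const_smul _
  obtain ⟨x, hx, hx0⟩ := exists_eq_zero_of_dist_self_lt
    (g := fun x => if h : x ∈ closedBall (0 : E) 1 then g ⟨x, h⟩ else 0)
    (by
      rw [continuousOn_iff_continuous_domRestrict]
      convert hg using 1
      ext x
      exact dif_pos x.2)
    (fun x hx => by simpa only [hx, dif_pos] using (hε ⟨x, hx⟩).2)
  simp only [hx, dif_pos, g] at hx0
  have h1 : e (Θ (ε, ⟨x, hx⟩)) = e q :=
    sub_eq_zero.1 ((smul_eq_zero.1 hx0).resolve_left (inv_ne_zero hR.ne'))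
  have h2 : Θ (ε, ⟨x, hx⟩) = q := e.injOn (hε _).1 hq h1
  have h3 : halfSpaceShift ε (φ (ψ ⟨x, hx⟩)) = φ ⟨q, hqU⟩ := by
    rw [← φ.symm_apply_eq]
    exact Subtype.ext h2
  rw [← h3] at hi0
  have h4 : 0 ≤ (φ (ψ ⟨x, hx⟩)).1 i := (φ (ψ ⟨x, hx⟩)).2 i hi
  have h5 : (φ (ψ ⟨x, hx⟩)).1 i + |ε| ≤ 0 := hi0
  rw [abs_of_pos hε0] at h5
  linarith

theorem connectedComponent_mem_nhds_of_mem_source {F E : Type*} [TopologicalSpace F]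
    [NormedAddCommGroup E] [NormedSpace ℝ E]
    (e : OpenPartialHomeomorph F E) {q : F} (hq : q ∈ e.source) :
    connectedComponent q ∈ 𝓝 q := by
  obtain ⟨R, hR, hRsub⟩ := Metric.nhds_basis_ball.mem_iff.1
    (e.open_target.mem_nhds (e.map_source hq))
  have h1 : IsPreconnected (e.symm '' ball (e q) R) :=
    (convex_ball (e q) R).isPreconnected.image _ (e.symm.continuousOn.mono hRsub)
  have h2 : q ∈ e.symm '' ball (e q) R := ⟨e q, mem_ball_self hR, e.left_inv hq⟩
  have h3 : IsOpen (e.symm '' ball (e q) R) :=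
    e.symm.isOpen_image_of_subset_source isOpen_ball hRsub
  exact mem_of_superset (h3.mem_nhds h2) (h1.subset_connectedComponent h2)

/-! ### Total differential equations and hyperplanes -/

theorem ContinuousLinearMap.mem_closure_pos {W : Type*} [NormedAddCommGroup W] [NormedSpace ℝ W]
    (f : W →L[ℝ] ℝ) (hf : f ≠ 0) {y : W} (hy : 0 ≤ f y) : y ∈ closure {z | 0 < f z} := by
  obtain ⟨z, hz⟩ : ∃ z, 0 < f z := by
    obtain ⟨z, hz⟩ := DFunLike.ne_iff.1 hf
    rcases lt_or_gt_of_ne hz with h | h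
    · exact ⟨-z, by simpa using h⟩
    · exact ⟨z, h⟩
  have ht : Tendsto (fun t : ℝ => y + t • z) (𝓝[>] 0) (𝓝 y) := by
    have : Tendsto (fun t : ℝ => y + t • z) (𝓝 0) (𝓝 (y + (0 : ℝ) • z)) :=
      (by fun_prop : Continuous fun t : ℝ => y + t • z).tendsto 0
    rw [zero_smul, add_zero] at this
    exact this.mono_left nhdsWithin_le_nhds
  refine mem_closure_of_tendsto ht ?_
  filter_upwards [self_mem_nhdsWithin] with t (h : 0 < t)
  have : 0 < t * f z := mul_pos h hz
  simp only [map_add, map_smul, smul_eq_mul]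
  linarith

theorem ContinuousLinearMap.dense_ne_zero {W : Type*} [NormedAddCommGroup W] [NormedSpace ℝ W]
    (f : W →L[ℝ] ℝ) (hf : f ≠ 0) : Dense {z | f z ≠ 0} := by
  intro y
  rcases le_total 0 (f y) with hy | hy
  · exact closure_mono (fun z hz => ne_of_gt hz) (f.mem_closure_pos hf hy)
  · refine closure_mono (fun z hz => ?_)
      ((-f).mem_closure_pos (neg_ne_zero.2 hf) (by simpa using hy))
    exact fun h => (ne_of_gt (show 0 < (-f) z from hz)) (by simp [h])

section TotalDifferential

variable {W V : Type*} [NormedAddCommGroup W] [NormedSpace ℝ W] [NormedAddCommGroup V]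
  [NormedSpace ℝ V] {Γ : W → V →L[ℝ] W →L[ℝ] V} {K : ℝ}

/-- Grönwall's inequality along segments for the total differential equation `du = Γ(u)`. -/
theorem norm_le_exp_of_hasFDerivWithinAt {C : Set W} (hC : Convex ℝ C)
    (hK : ∀ y ∈ C, ‖Γ y‖ ≤ K) {u : W → V}
    (hu : ∀ y ∈ C, HasFDerivWithinAt u (Γ y (u y)) C y) {x y : W} (hx : x ∈ C) (hy : y ∈ C) :
    ‖u y‖ ≤ ‖u x‖ * Real.exp (K * ‖y - x‖) := by
  let γ : ℝ → W := fun t => x + t • (y - x)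
  have hγ : ∀ t ∈ Icc (0 : ℝ) 1, γ t ∈ C := fun t ht => hC.add_smul_sub_mem hx hy ht
  have hγd : ∀ t, HasDerivAt γ (y - x) t := fun t => by
    have := ((hasDerivAt_id t).smul_const (y - x)).const_add x
    rwa [one_smul] at this
  have hd : ∀ t ∈ Icc (0 : ℝ) 1,
      HasDerivWithinAt (u ∘ γ) (Γ (γ t) (u (γ t)) (y - x)) (Icc 0 1) t := fun t ht =>
    (hu _ (hγ t ht)).comp_hasDerivWithinAt t (hγd t).hasDerivWithinAt hγ
  have := norm_le_gronwallBound_of_norm_deriv_right_le (f := u ∘ γ)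
    (f' := fun t => Γ (γ t) (u (γ t)) (y - x)) (δ := ‖u x‖) (K := K * ‖y - x‖) (ε := 0)
    (a := 0) (b := 1) (fun t ht => (hd t ht).continuousWithinAt)
    (fun t ht => (hd t (Ico_subset_Icc_self ht)).mono_of_mem_nhdsWithin
      (Icc_mem_nhdsGE_of_mem ht)) (by simp [γ]) (fun t ht => ?_) 1 (by simp)
  · simpa [γ, gronwallBound_ε0] using this
  · have h1 := hK _ (hγ t (Ico_subset_Icc_self ht))
    calc ‖Γ (γ t) (u (γ t)) (y - x)‖ ≤ ‖Γ (γ t)‖ * ‖u (γ t)‖ * ‖y - x‖ :=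
          (Γ (γ t)).le_opNorm₂ _ _
      _ ≤ K * ‖u (γ t)‖ * ‖y - x‖ := by gcongr
      _ = _ := by simp only [Function.comp]; ring

/-- A solution of `du = Γ(u)` on a bounded convex open set `C` is bounded, hence Lipschitz, so it
extends continuously to the closure, and the extension is still a solution. -/
theorem hasFDerivWithinAt_extendFrom [CompleteSpace V] {C S : Set W} (hC : Convex ℝ C)
    (hCo : IsOpen C) (hCb : Bornology.IsBounded C) (hCS : C ⊆ S) (hSC : S ⊆ closure C)
    (hΓ : ContinuousOn Γ S) (hK : ∀ y ∈ C, ‖Γ y‖ ≤ K) {u : W → V}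
    (hu : ∀ y ∈ C, HasFDerivAt u (Γ y (u y)) y) :
    (∀ y ∈ C, extendFrom C u y = u y) ∧
    (∀ y ∈ S, Tendsto u (𝓝[C] y) (𝓝 (extendFrom C u y))) ∧
    ∀ y ∈ S, HasFDerivWithinAt (extendFrom C u) (Γ y (extendFrom C u y)) S y := by
  have heq : ∀ y ∈ C, extendFrom C u y = u y := fun y hy =>
    extendFrom_eq (subset_closure hy) ((hu y hy).continuousAt.tendsto.mono_left nhdsWithin_le_nhds)
  have hLip : ∃ L, LipschitzOnWith L u C := by
    rcases C.eq_empty_or_nonempty with rfl | ⟨x₀, hx₀⟩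
    · exact ⟨0, by simp⟩
    obtain ⟨R, hR⟩ := hCb.subset_closedBall x₀
    have hK0 : 0 ≤ K := (norm_nonneg (Γ x₀)).trans (hK x₀ hx₀)
    set Q := ‖u x₀‖ * Real.exp (K * R)
    have hbd : ∀ y ∈ C, ‖u y‖ ≤ Q := fun y hy => by
      refine (norm_le_exp_of_hasFDerivWithinAt hC hK
        (fun z hz => (hu z hz).hasFDerivWithinAt) hx₀ hy).trans ?_
      have := hR hy
      rw [mem_closedBall, dist_eq_norm] at this
      change _ ≤ ‖u x₀‖ * Real.exp (K * R)
      gcongr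
    refine ⟨(K * Q).toNNReal, hC.lipschitzOnWith_of_nnnorm_hasFDerivWithin_le
      (fun y hy => (hu y hy).hasFDerivWithinAt) fun y hy => ?_⟩
    rw [← NNReal.coe_le_coe, coe_nnnorm]
    refine le_trans ?_ (Real.le_coe_toNNReal _)
    refine ((Γ y).le_opNorm _).trans ?_
    have := hbd y hy
    have := hK y hy
    gcongr
  obtain ⟨L, hL⟩ := hLip
  have hlim : ∀ y ∈ closure C, ∃ v, Tendsto u (𝓝[C] y) (𝓝 v) := by
    intro y hy
    have : (𝓝[C] y).NeBot := mem_closure_iff_nhdsWithin_neBot.1 hy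
    have hc : Cauchy (map u (𝓝[C] y)) :=
      (cauchy_nhds.mono nhdsWithin_le_nhds).map_of_le hL.uniformContinuousOn
        (le_principal_iff.2 self_mem_nhdsWithin)
    exact cauchy_iff_exists_le_nhds.1 hc
  have hcont : ContinuousOn (extendFrom C u) (closure C) := continuousOn_extendFrom Subset.rfl hlim
  refine ⟨heq, fun y hy => tendsto_extendFrom (hlim y (hSC hy)), fun y hy => ?_⟩
  have hder : ∀ z ∈ C, HasFDerivAt (extendFrom C u) (Γ z (u z)) z := fun z hz =>
    (hu z hz).congr_of_eventuallyEq
      (by filter_upwards [hCo.mem_nhds hz] with w hw using heq w hw)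
  refine (hasFDerivWithinAt_closure_of_tendsto_fderiv
    (fun z hz => (hder z hz).differentiableAt.differentiableWithinAt) hC hCo
    (fun z hz => (hcont z hz).mono subset_closure) ?_).mono hSC
  have h1 : Tendsto (fun z => Γ z (extendFrom C u z)) (𝓝[C] y) (𝓝 (Γ y (extendFrom C u y))) :=
    ((hΓ y hy).mono hCS).clm_apply ((hcont y (hSC hy)).mono subset_closure)
  refine h1.congr' ?_
  filter_upwards [self_mem_nhdsWithin] with z hz
  rw [(hder z hz).fderiv, heq z hz]

/-- A solution of `du = Γ(u)` on an open convex set `B` minus a hyperplane that has a limit at one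
point of the hyperplane extends to a solution on `B`. Its extensions from the two sides differ on
the hyperplane by a solution that vanishes at one point, hence everywhere. -/
theorem exists_extension_across_hyperplane [CompleteSpace V] {B : Set W} (hB : Convex ℝ B)
    (hBo : IsOpen B) (hBb : Bornology.IsBounded B) (hΓ : ContinuousOn Γ B)
    (hK : ∀ y ∈ B, ‖Γ y‖ ≤ K) {f : W →L[ℝ] ℝ} (hf : f ≠ 0) {u : W → V}
    (hu : ∀ y ∈ B, f y ≠ 0 → HasFDerivAt u (Γ y (u y)) y)
    {y₁ : W} (hy₁ : y₁ ∈ B) (hfy₁ : f y₁ = 0) {v : V}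
    (hv : Tendsto u (𝓝[{y | f y ≠ 0}] y₁) (𝓝 v)) :
    ∃ u' : W → V, (∀ y ∈ B, f y ≠ 0 → u' y = u y) ∧
      ∀ y ∈ B, HasFDerivAt u' (Γ y (u' y)) y := by
  classical
  -- the extension from the side `0 < g`, to be used for `g = f` and `g = -f`
  have half : ∀ g : W →L[ℝ] ℝ, g ≠ 0 → (∀ y, g y ≠ 0 → f y ≠ 0) → (∀ y, f y = 0 → g y = 0) →
      ∃ w : W → V, (∀ y ∈ B, 0 < g y → w y = u y) ∧ w y₁ = v ∧
        ∀ y ∈ B, 0 ≤ g y → HasFDerivWithinAt w (Γ y (w y)) (B ∩ {y | 0 ≤ g y}) y := by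
    intro g hg hgf hfg
    have hSC : B ∩ {y | 0 ≤ g y} ⊆ closure (B ∩ {y | 0 < g y}) := by
      rintro y ⟨hyB, hy⟩
      exact hBo.inter_closure ⟨hyB, g.mem_closure_pos hg hy⟩
    have hCS : B ∩ {y | 0 < g y} ⊆ B ∩ {y | 0 ≤ g y} := fun y hy =>
      ⟨hy.1, (show 0 < g y from hy.2).le⟩
    have hopen : IsOpen (B ∩ {y | 0 < g y}) := hBo.inter (isOpen_lt continuous_const g.continuous)
    obtain ⟨h1, h2, h3⟩ := hasFDerivWithinAt_extendFrom (u := u)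
      (hB.inter (convex_halfSpace_gt g.toLinearMap.isLinear 0)) hopen
      (hBb.subset inter_subset_left) hCS hSC (hΓ.mono inter_subset_left)
      (fun y hy => hK y hy.1) (fun y hy => hu y hy.1 (hgf y (ne_of_gt hy.2)))
    refine ⟨_, fun y hy h => h1 y ⟨hy, h⟩, ?_, fun y hy h => h3 y ⟨hy, h⟩⟩
    have hmem : y₁ ∈ B ∩ {y | 0 ≤ g y} := ⟨hy₁, (hfg y₁ hfy₁).ge⟩
    have : (𝓝[B ∩ {y | 0 < g y}] y₁).NeBot := mem_closure_iff_nhdsWithin_neBot.1 (hSC hmem)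
    exact tendsto_nhds_unique (h2 y₁ hmem)
      (hv.mono_left (nhdsWithin_mono _ fun y hy => hgf y (ne_of_gt hy.2)))
  obtain ⟨p, hp1, hp2, hp3⟩ := half f hf (fun _ => id) (fun _ => id)
  obtain ⟨m, hm1, hm2, hm3⟩ := half (-f) (neg_ne_zero.2 hf) (fun y => by simp) (fun y => by simp)
  have hjump : ∀ y ∈ B, f y = 0 → p y = m y := by
    intro y hy hfy
    have hconv : Convex ℝ (B ∩ {y | f y = 0}) :=
      hB.inter (convex_hyperplane f.toLinearMap.isLinear 0)
    have := norm_le_exp_of_hasFDerivWithinAt (u := fun y => p y - m y) hconv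
      (fun z hz => hK z hz.1) (fun z hz => ?_) ⟨hy₁, hfy₁⟩ ⟨hy, hfy⟩
    · rw [hp2, hm2, sub_self, norm_zero, zero_mul] at this
      exact sub_eq_zero.1 (norm_le_zero_iff.1 this)
    · have hz0 : f z = 0 := hz.2
      rw [map_sub]
      exact ((hp3 z hz.1 hz0.ge).mono fun w hw => ⟨hw.1, (show f w = 0 from hw.2).ge⟩).sub
        ((hm3 z hz.1 (by simp [hz0])).mono fun w hw =>
          ⟨hw.1, by simp [show f w = 0 from hw.2]⟩)
  let u' : W → V := fun y => if 0 ≤ f y then p y else m y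
  have hu'p : ∀ y, 0 ≤ f y → u' y = p y := fun y hy => if_pos hy
  have hu'm : ∀ y ∈ B, 0 ≤ (-f) y → u' y = m y := fun y hyB hy => by
    have hy' : f y ≤ 0 := by simpa using hy
    rcases hy'.eq_or_lt with h | h
    · rw [hu'p y h.ge, hjump y hyB h]
    · exact if_neg (not_le.2 h)
  have hdp : ∀ y ∈ B, 0 ≤ f y → HasFDerivWithinAt u' (Γ y (u' y)) (B ∩ {y | 0 ≤ f y}) y := by
    intro y hy h
    rw [hu'p y h]
    exact (hp3 y hy h).congr (fun z hz => hu'p z hz.2) (hu'p y h)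
  have hdm : ∀ y ∈ B, 0 ≤ (-f) y →
      HasFDerivWithinAt u' (Γ y (u' y)) (B ∩ {y | 0 ≤ (-f) y}) y := by
    intro y hy h
    rw [hu'm y hy h]
    exact (hm3 y hy h).congr (fun z hz => hu'm z hz.1 hz.2) (hu'm y hy h)
  refine ⟨u', fun y hy h => ?_, fun y hy => ?_⟩
  · rcases lt_or_gt_of_ne h with h | h
    · rw [hu'm y hy (by simpa using h.le), hm1 y hy (by simpa using h)]
    · rw [hu'p y h.le, hp1 y hy h]
  · rcases lt_trichotomy (f y) 0 with h | h | h
    · refine (hdm y hy (by simpa using h.le)).hasFDerivAt ?_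
      filter_upwards [hBo.mem_nhds hy, (isOpen_lt f.continuous continuous_const).mem_nhds h]
        with z hz (hz' : f z < 0) using ⟨hz, by simpa using hz'.le⟩
    · refine ((hdp y hy h.ge).union (hdm y hy (by simp [h]))).hasFDerivAt ?_
      filter_upwards [hBo.mem_nhds hy] with z hz
      rcases le_total 0 (f z) with h' | h'
      · exact Or.inl ⟨hz, h'⟩
      · exact Or.inr ⟨hz, by simpa using h'⟩
    · refine (hdp y hy h.le).hasFDerivAt ?_
      filter_upwards [hBo.mem_nhds hy, (isOpen_lt continuous_const f.continuous).mem_nhds h]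
        with z hz (hz' : 0 < f z) using ⟨hz, hz'.le⟩

end TotalDifferential

/-! ### Connections in local trivializations -/

namespace CkManifold

variable {k : ℕ∞} {M : Type u} [TopologicalSpace M] {X : CkManifold k M}

theorem CmOn.of_le {m n : ℕ∞} {V : Type*} [NormedAddCommGroup V] [NormedSpace ℝ V] {f : M → V}
    {U : Set M} (hf : X.CmOn n f U) (h : m ≤ n) : X.CmOn m f U := fun e he =>
  (hf e he).of_le (by exact_mod_cast h)

theorem CmOn.differentiableAt {m : ℕ∞} (hm : 1 ≤ m) {V : Type*} [NormedAddCommGroup V]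
    [NormedSpace ℝ V] {f : M → V} {U : Set M} (hU : IsOpen U) (hf : X.CmOn m f U) {p : M}
    (hp : p ∈ U) (e : X.ChartAt p) : DifferentiableAt ℝ (f ∘ e.1.2.symm) (e.1.2 p) := by
  refine ((hf e.1 e.2.1).differentiableOn ?_).differentiableAt
    ((e.1.2.symm.isOpen_inter_preimage hU).mem_nhds ⟨e.1.2.map_source e.2.2, ?_⟩)
  · exact_mod_cast (zero_lt_one.trans_le hm).ne'
  · rwa [mem_preimage, e.1.2.left_inv e.2.2]

theorem differentiableAt_chart_change (hk : 1 ≤ k) {p : M} (e e' : X.ChartAt p) :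
    DifferentiableAt ℝ (e'.1.2 ∘ e.1.2.symm) (e.1.2 p) := by
  refine ((X.compatible e.1 e.2.1 e'.1 e'.2.1).differentiableOn ?_).differentiableAt
    ((e.1.2.symm.isOpen_inter_preimage e'.1.2.open_source).mem_nhds
      ⟨e.1.2.map_source e.2.2, ?_⟩)
  · exact_mod_cast (zero_lt_one.trans_le hk).ne'
  · rw [mem_preimage, e.1.2.left_inv e.2.2]; exact e'.2.2

/-- Every vector of the model space represents a tangent vector in a given chart. -/
theorem exists_tangent_apply_eq (hk : 1 ≤ k) {p : M} (e : X.ChartAt p) (x : Fin e.1.1 → ℝ) :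
    ∃ v : X.TangentAt p, v.1 e = x := by
  refine ⟨⟨fun e' => fderiv ℝ (e'.1.2 ∘ e.1.2.symm) (e.1.2 p) x, fun e' e'' => ?_⟩, ?_⟩
  · have hp : (e'.1.2 ∘ e.1.2.symm) (e.1.2 p) = e'.1.2 p := by simp [e.1.2.left_inv e.2.2]
    have h1 := differentiableAt_chart_change hk e e'
    have h2 := differentiableAt_chart_change hk e' e''
    rw [← hp] at h2
    have h3 := fderiv_comp (e.1.2 p) h2 h1
    rw [hp] at h3
    change (fderiv ℝ (e''.1.2 ∘ e'.1.2.symm) (e'.1.2 p)).comp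
      (fderiv ℝ (e'.1.2 ∘ e.1.2.symm) (e.1.2 p)) x = _
    rw [← h3]
    congr 1
    refine Filter.EventuallyEq.fderiv_eq ?_
    filter_upwards [(e.1.2.symm.isOpen_inter_preimage e'.1.2.open_source).mem_nhds
      ⟨e.1.2.map_source e.2.2, by rw [mem_preimage, e.1.2.left_inv e.2.2]; exact e'.2.2⟩] with y hy
    simp [e'.1.2.left_inv hy.2]
  · have : e.1.2 ∘ e.1.2.symm =ᶠ[𝓝 (e.1.2 p)] id := by
      filter_upwards [e.1.2.open_target.mem_nhds (e.1.2.map_source e.2.2)] with y hy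
        using e.1.2.right_inv hy
    change fderiv ℝ (e.1.2 ∘ e.1.2.symm) (e.1.2 p) x = x
    rw [this.fderiv_eq, fderiv_id]
    rfl

end CkManifold

section Bundles

variable {k : ℕ∞} {M : Type u} [TopologicalSpace M] {X : CkManifold k M} {l : ℕ∞}
  {E : M → Type w} [∀ p, AddCommGroup (E p)] [∀ p, Module ℝ (E p)]

namespace ClVectorBundle

variable {B : ClVectorBundle X l E}

/-- The `i`-th section of the frame over `t.base` given by the local trivialization `t`. -/
def frame (hl : 1 ≤ l) (t : LocalTriv E) (ht : t ∈ B.trivs) (i : Fin t.rank) :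
    B.sections 1 t.base :=
  ⟨t.constSection (Pi.single i 1), fun t' ht' => (B.compatible t ht t' ht' _).of_le hl⟩

/-- A combination of the sections of a frame with `C¹` coefficients. -/
noncomputable def frameSum (hl : 1 ≤ l) (t : LocalTriv E) (ht : t ∈ B.trivs) {U : Opens M}
    (hU : U ≤ t.base) (c : M → Fin t.rank → ℝ) (hc : ∀ i, X.CmOn 1 (fun q => c q i) U) :
    B.sections 1 U :=
  ∑ i, B.mulSection (fun q => c q i) (hc i) (B.restrict hU (frame hl t ht i))

theorem frameSum_apply (hl : 1 ≤ l) (t : LocalTriv E) (ht : t ∈ B.trivs) {U : Opens M}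
    (hU : U ≤ t.base) (c : M → Fin t.rank → ℝ) (hc : ∀ i, X.CmOn 1 (fun q => c q i) U) (p : U) :
    (frameSum hl t ht hU c hc).1 p = (t.equiv ⟨p, hU p.2⟩).symm (c p) := by
  rw [frameSum, AddSubgroup.val_finsetSum, Finset.sum_apply]
  change ∑ i, c p i • (t.equiv ⟨p, hU p.2⟩).symm (Pi.single i 1) = _
  simp_rw [← map_smul, ← map_sum]
  congr 1
  ext j
  simp [Finset.sum_apply, Pi.single_apply]

theorem cmOn_coord_apply {U : Opens M} (s : B.sections 1 U) {t : LocalTriv E} (ht : t ∈ B.trivs)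
    (i : Fin t.rank) : X.CmOn 1 (fun q => t.coord s.1 q i) (U ∩ t.base) := fun e he =>
  contDiffOn_pi.1 (s.2 t ht e he) i

/-- The evaluation of a form at a tangent vector, in a local trivialization. -/
def evalForm (t : LocalTriv E) {U : Opens M} {p : M} (hp : p ∈ U) (hb : p ∈ t.base)
    (v : X.TangentAt p) : B.forms U →+ (Fin t.rank → ℝ) where
  toFun ξ := t.equiv ⟨p, hb⟩ (ξ.1 ⟨p, hp⟩ v)
  map_zero' := (t.equiv ⟨p, hb⟩).map_zero
  map_add' ξ ξ' := (t.equiv ⟨p, hb⟩).map_add (ξ.1 ⟨p, hp⟩ v) (ξ'.1 ⟨p, hp⟩ v)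

namespace Connection

theorem toHom_mulSection_apply (D : B.Connection) {U : Opens M} {f : M → ℝ} (hf : X.CmOn 1 f U)
    (s : B.sections 1 U) {p : M} (hU : p ∈ U) (e : X.ChartAt p) (v : X.TangentAt p) :
    (D.toHom U (B.mulSection f hf s)).1 ⟨p, hU⟩ v =
      fderiv ℝ (f ∘ e.1.2.symm) (e.1.2 p) (v.1 e) • s.1 ⟨p, hU⟩ +
        f p • (D.toHom U s).1 ⟨p, hU⟩ v :=
  LinearMap.congr_fun (D.leibniz U f hf s ⟨p, hU⟩ e) v

theorem toHom_restrict_apply (D : B.Connection) {U V : Opens M} (h : V ≤ U) (s : B.sections 1 U)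
    {p : M} (hV : p ∈ V) (v : X.TangentAt p) :
    (D.toHom V (B.restrict h s)).1 ⟨p, hV⟩ v = (D.toHom U s).1 ⟨p, h hV⟩ v :=
  LinearMap.congr_fun (D.map_restrict U V h s ⟨p, hV⟩) v

/-- The covariant derivative in a chart and a local trivialization: the derivative of the
coordinates plus a linear combination of the derivatives of the frame. -/
theorem equiv_toHom_apply (D : B.Connection) (hl : 1 ≤ l) {t : LocalTriv E} (ht : t ∈ B.trivs)
    {U : Opens M} (s : B.sections 1 U) {p : M} (hU : p ∈ U) (hb : p ∈ t.base) (e : X.ChartAt p)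
    (v : X.TangentAt p) :
    t.equiv ⟨p, hb⟩ ((D.toHom U s).1 ⟨p, hU⟩ v) =
      fderiv ℝ (t.coord s.1 ∘ e.1.2.symm) (e.1.2 p) (v.1 e) +
        ∑ i, t.coord s.1 p i •
          t.equiv ⟨p, hb⟩ ((D.toHom t.base (frame hl t ht i)).1 ⟨p, hb⟩ v) := by
  have hUb : p ∈ U ⊓ t.base := ⟨hU, hb⟩
  have hdec : B.restrict inf_le_left s =
      frameSum hl t ht (U := U ⊓ t.base) inf_le_right (t.coord s.1) (cmOn_coord_apply s ht) := by
    refine Subtype.ext (funext fun q => ?_)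
    rw [frameSum_apply, LocalTriv.coord_of_mem t s.1 q.2.1 q.2.2, LinearEquiv.symm_apply_apply]
    rfl
  let ev : B.sections 1 (U ⊓ t.base) →+ (Fin t.rank → ℝ) :=
    (evalForm t hUb hb v).comp (D.toHom (U ⊓ t.base))
  have h1 : t.equiv ⟨p, hb⟩ ((D.toHom U s).1 ⟨p, hU⟩ v) = ev (B.restrict inf_le_left s) :=
    congrArg (t.equiv ⟨p, hb⟩) (D.toHom_restrict_apply inf_le_left s hUb v).symm
  rw [h1, hdec]
  refine (map_sum ev _ _).trans ?_
  have hdiff : DifferentiableAt ℝ (t.coord s.1 ∘ e.1.2.symm) (e.1.2 p) :=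
    CkManifold.CmOn.differentiableAt le_rfl (U.isOpen.inter t.base.isOpen) (s.2 t ht) ⟨hU, hb⟩ e
  have h2 : ∀ i, ev (B.mulSection (fun q => t.coord s.1 q i)
      (show X.CmOn 1 (fun q => t.coord s.1 q i) (U ⊓ t.base : Opens M) from
        cmOn_coord_apply s ht i)
        (B.restrict inf_le_right (frame hl t ht i))) =
      (Pi.single i (fderiv ℝ (t.coord s.1 ∘ e.1.2.symm) (e.1.2 p) (v.1 e) i) : Fin t.rank → ℝ) +
        t.coord s.1 p i • t.equiv ⟨p, hb⟩ ((D.toHom t.base (frame hl t ht i)).1 ⟨p, hb⟩ v) := by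
    intro i
    have h3 : fderiv ℝ ((fun q => t.coord s.1 q i) ∘ e.1.2.symm) (e.1.2 p) (v.1 e) =
        fderiv ℝ (t.coord s.1 ∘ e.1.2.symm) (e.1.2 p) (v.1 e) i := by
      have := (hasFDerivAt_pi'.1 hdiff.hasFDerivAt i).fderiv
      exact DFunLike.congr_fun this (v.1 e)
    have h4 : t.equiv ⟨p, hb⟩ ((B.restrict (inf_le_right : U ⊓ t.base ≤ t.base)
        (frame hl t ht i)).1 ⟨p, hUb⟩) = Pi.single i 1 :=
      (t.equiv ⟨p, hb⟩).apply_symm_apply _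
    have h5 := congrArg (t.equiv ⟨p, hb⟩) (D.toHom_mulSection_apply
      (show X.CmOn 1 (fun q => t.coord s.1 q i) (U ⊓ t.base : Opens M) from
        cmOn_coord_apply s ht i)
        (B.restrict inf_le_right (frame hl t ht i)) hUb e v)
    refine h5.trans (((t.equiv ⟨p, hb⟩).map_add _ _).trans (congrArg₂ _
      (((t.equiv ⟨p, hb⟩).map_smul _ _).trans ?_) (((t.equiv ⟨p, hb⟩).map_smul _ _).trans ?_)))
    · rw [h4, h3, ← Pi.single_smul, smul_eq_mul, mul_one]
    · exact congrArg (fun z => t.coord s.1 p i • t.equiv ⟨p, hb⟩ z)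
        (D.toHom_restrict_apply inf_le_right (frame hl t ht i) hUb v)
  refine (Finset.sum_congr rfl fun i _ => h2 i).trans ?_
  rw [Finset.sum_add_distrib, Finset.univ_sum_single]

end Connection

end ClVectorBundle

end Bundles

/-! ### Parallel sections in charts -/

section Bundles

variable {k : ℕ∞} {M : Type u} [TopologicalSpace M] {X : CkManifold k M} {l : ℕ∞}
  {E : M → Type w} [∀ p, AddCommGroup (E p)] [∀ p, Module ℝ (E p)]

namespace ClVectorBundle

variable {B : ClVectorBundle X l E}

namespace Connection

/-- In a chart of the atlas and a local trivialization, a section is parallel at a point if and only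
if its coordinates satisfy a total differential equation `du = Γ(u)` with continuous `Γ`. -/
theorem exists_christoffel_of_mem_atlas (hk : 1 ≤ k) (hl : 1 ≤ l) (D : B.Connection)
    {t : LocalTriv E} (ht : t ∈ B.trivs) {n : ℕ} (e : OpenPartialHomeomorph M (Fin n → ℝ))
    (he : ⟨n, e⟩ ∈ X.atlas) :
    ∃ Γ : (Fin n → ℝ) → (Fin t.rank → ℝ) →L[ℝ] (Fin n → ℝ) →L[ℝ] (Fin t.rank → ℝ),
      ContinuousOn Γ (e.target ∩ e.symm ⁻¹' t.base) ∧
      ∀ (U : Opens M) (s : B.sections 1 U) (p : M) (hU : p ∈ U), p ∈ t.base → p ∈ e.source →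
        ((D.toHom U s).1 ⟨p, hU⟩ = 0 ↔
          HasFDerivAt (t.coord s.1 ∘ e.symm) (Γ (e p) (t.coord s.1 p)) (e p)) := by
  choose A hA hA' using fun i => (D.toHom t.base (frame hl t ht i)).2 t ht ⟨n, e⟩ he
  refine ⟨fun y => -∑ i, ContinuousLinearMap.smulRightL ℝ _ _
    (ContinuousLinearMap.proj i) (A i (e.symm y)), ?_, ?_⟩
  · have hterm : ∀ i, ContinuousOn (fun y => ContinuousLinearMap.smulRightL ℝ (Fin t.rank → ℝ)
        ((Fin n → ℝ) →L[ℝ] (Fin t.rank → ℝ)) (ContinuousLinearMap.proj i) (A i (e.symm y)))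
        (e.target ∩ e.symm ⁻¹' t.base) := fun i =>
      ContinuousLinearMap.continuous _ |>.comp_continuousOn <|
        (hA i).comp (e.symm.continuousOn.mono inter_subset_left) fun y hy =>
          ⟨⟨hy.2, hy.2⟩, e.map_target hy.1⟩
    exact (continuousOn_finsetSum Finset.univ fun i _ => hterm i).neg
  · intro U s p hU hb hp
    let c : X.ChartAt p := ⟨⟨n, e⟩, he, hp⟩
    have hdiff : DifferentiableAt ℝ (t.coord s.1 ∘ e.symm) (e p) :=
      CkManifold.CmOn.differentiableAt le_rfl (U.isOpen.inter t.base.isOpen) (s.2 t ht) ⟨hU, hb⟩ c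
    have key : ∀ v : X.TangentAt p, t.equiv ⟨p, hb⟩ ((D.toHom U s).1 ⟨p, hU⟩ v) =
        fderiv ℝ (t.coord s.1 ∘ e.symm) (e p) (v.1 c) +
          ∑ i, t.coord s.1 p i • A i p (v.1 c) := by
      intro v
      refine (D.equiv_toHom_apply hl ht s hU hb c v).trans (congrArg₂ _ rfl ?_)
      exact Finset.sum_congr rfl fun i _ => congrArg _ (hA' i p hb hb hp v)
    have hΓ : ∀ x, (-∑ i, ContinuousLinearMap.smulRightL ℝ (Fin t.rank → ℝ)
        ((Fin n → ℝ) →L[ℝ] (Fin t.rank → ℝ)) (ContinuousLinearMap.proj i) (A i (e.symm (e p))))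
        (t.coord s.1 p) x =
        -∑ i, t.coord s.1 p i • A i p x := by
      intro x
      rw [e.left_inv hp]
      simp
    constructor
    · intro h
      convert hdiff.hasFDerivAt
      ext1 x
      obtain ⟨v, rfl⟩ := CkManifold.exists_tangent_apply_eq hk c x
      have h1 := key v
      have h2 : t.equiv ⟨p, hb⟩ ((D.toHom U s).1 ⟨p, hU⟩ v) = 0 := by
        rw [h]; exact (t.equiv ⟨p, hb⟩).map_zero
      rw [hΓ, neg_eq_iff_add_eq_zero, add_comm, ← h1, h2]
    · intro h
      refine LinearMap.ext fun v => (t.equiv ⟨p, hb⟩).injective ?_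
      refine (key v).trans (Eq.trans ?_ (t.equiv ⟨p, hb⟩).map_zero.symm)
      rw [h.fderiv, hΓ, neg_add_cancel]

/-- The same in a `C¹` chart with values in an arbitrary normed space. -/
theorem exists_christoffel (hk : 1 ≤ k) (hl : 1 ≤ l) (D : B.Connection)
    {t : LocalTriv E} (ht : t ∈ B.trivs) {W : Type*} [NormedAddCommGroup W] [NormedSpace ℝ W]
    {φ : OpenPartialHomeomorph M W} (hφ : X.IsCmIso 1 φ) {p₀ : M} (hp₀ : p₀ ∈ φ.source)
    (hb₀ : p₀ ∈ t.base) :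
    ∃ N : Opens M, p₀ ∈ N ∧ (N : Set M) ⊆ φ.source ∧ N ≤ t.base ∧
    ∃ Γ : W → (Fin t.rank → ℝ) →L[ℝ] W →L[ℝ] (Fin t.rank → ℝ),
      ContinuousOn Γ (φ.target ∩ φ.symm ⁻¹' N) ∧
      ∀ (U : Opens M) (s : B.sections 1 U) (p : M) (hU : p ∈ U), p ∈ N →
        ((D.toHom U s).1 ⟨p, hU⟩ = 0 ↔
          HasFDerivAt (t.coord s.1 ∘ φ.symm) (Γ (φ p) (t.coord s.1 p)) (φ p)) := by
  obtain ⟨⟨n, e⟩, he, hpe⟩ := X.cover p₀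
  replace hpe : p₀ ∈ e.source := hpe
  obtain ⟨Γ, hΓ, hiff⟩ := exists_christoffel_of_mem_atlas hk hl D ht e he
  obtain ⟨hc1, hc2⟩ := hφ _ he
  change ContDiffOn ℝ 1 (φ ∘ e.symm) (e.target ∩ e.symm ⁻¹' φ.source) at hc1
  change ContDiffOn ℝ 1 (e ∘ φ.symm) (φ.target ∩ φ.symm ⁻¹' e.source) at hc2
  have ho1 : IsOpen (e.target ∩ e.symm ⁻¹' φ.source) := e.symm.isOpen_inter_preimage φ.open_source
  have ho2 : IsOpen (φ.target ∩ φ.symm ⁻¹' e.source) := φ.symm.isOpen_inter_preimage e.open_source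
  let N : Opens M := ⟨e.source ∩ φ.source ∩ t.base,
    (e.open_source.inter φ.open_source).inter t.base.isOpen⟩
  refine ⟨N, ⟨⟨hpe, hp₀⟩, hb₀⟩, fun _ h => h.1.2, fun _ h => h.2,
    fun y => (ContinuousLinearMap.compL ℝ W (Fin n → ℝ) (Fin t.rank → ℝ)).flip
      (fderiv ℝ (e ∘ φ.symm) y) ∘L Γ (e (φ.symm y)), ?_, ?_⟩
  · have h1 : ContinuousOn (fun y => fderiv ℝ (e ∘ φ.symm) y) (φ.target ∩ φ.symm ⁻¹' N) :=
      (hc2.continuousOn_fderiv_of_isOpen ho2 le_rfl).mono fun y hy => ⟨hy.1, hy.2.1.1⟩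
    have h2 : ContinuousOn (fun y => Γ (e (φ.symm y))) (φ.target ∩ φ.symm ⁻¹' N) := by
      refine hΓ.comp (e.continuousOn.comp (φ.symm.continuousOn.mono inter_subset_left)
        fun y hy => hy.2.1.1) fun y hy => ⟨e.map_source hy.2.1.1, ?_⟩
      rw [mem_preimage, e.left_inv hy.2.1.1]
      exact hy.2.2
    exact ((ContinuousLinearMap.continuous _).comp_continuousOn h1).clm_comp h2
  · intro U s p hU hN
    obtain ⟨⟨hp1, hp2⟩, hp3⟩ := hN
    rw [hiff U s p hU hp3 hp1]
    have m1 : e p ∈ e.target ∩ e.symm ⁻¹' φ.source :=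
      ⟨e.map_source hp1, by rwa [mem_preimage, e.left_inv hp1]⟩
    have m2 : φ p ∈ φ.target ∩ φ.symm ⁻¹' e.source :=
      ⟨φ.map_source hp2, by rwa [mem_preimage, φ.left_inv hp2]⟩
    have d1 : HasFDerivAt (φ ∘ e.symm) (fderiv ℝ (φ ∘ e.symm) (e p)) (e p) :=
      ((hc1.differentiableOn one_ne_zero).differentiableAt (ho1.mem_nhds m1)).hasFDerivAt
    have d2 : HasFDerivAt (e ∘ φ.symm) (fderiv ℝ (e ∘ φ.symm) (φ p)) (φ p) :=
      ((hc2.differentiableOn one_ne_zero).differentiableAt (ho2.mem_nhds m2)).hasFDerivAt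
    have v1 : (φ ∘ e.symm) (e p) = φ p := by simp [e.left_inv hp1]
    have v2 : (e ∘ φ.symm) (φ p) = e p := by simp [φ.left_inv hp2]
    have hval : ((ContinuousLinearMap.compL ℝ W (Fin n → ℝ) (Fin t.rank → ℝ)).flip
        (fderiv ℝ (e ∘ φ.symm) (φ p)) ∘L Γ (e (φ.symm (φ p)))) (t.coord s.1 p) =
        (Γ (e p) (t.coord s.1 p)).comp (fderiv ℝ (e ∘ φ.symm) (φ p)) := by
      rw [φ.left_inv hp2]
      rfl
    rw [hval]
    constructor
    · intro h
      rw [← v2] at h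
      have h1 := h.comp (φ p) d2
      rw [v2] at h1
      refine h1.congr_of_eventuallyEq ?_
      filter_upwards [ho2.mem_nhds m2] with y hy
      simp [e.left_inv hy.2]
    · intro h
      rw [← v1] at h
      have h1 := h.comp (e p) d1
      rw [v1] at h1
      -- the two coordinate changes have inverse derivatives
      have hinv : (fderiv ℝ (e ∘ φ.symm) (φ p)).comp (fderiv ℝ (φ ∘ e.symm) (e p)) =
          ContinuousLinearMap.id ℝ _ := by
        rw [← v1] at d2
        have h2 := d2.comp (e p) d1
        rw [v1] at h2
        refine h2.unique ((hasFDerivAt_id (e p)).congr_of_eventuallyEq ?_)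
        filter_upwards [ho1.mem_nhds m1] with y hy
        simp [φ.left_inv hy.2, e.right_inv hy.1]
      rw [ContinuousLinearMap.comp_assoc, hinv, ContinuousLinearMap.comp_id] at h1
      refine h1.congr_of_eventuallyEq ?_
      filter_upwards [ho1.mem_nhds m1] with y hy
      simp [φ.left_inv hy.2]

theorem mem_parallelSections_iff (D : B.Connection) {U : Opens M} {s : B.sections 1 U} :
    s ∈ D.parallelSections U ↔ ∀ (p : M) (hU : p ∈ U), (D.toHom U s).1 ⟨p, hU⟩ = 0 := by
  rw [parallelSections, AddMonoidHom.mem_ker]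
  exact ⟨fun h p hU => by rw [h]; rfl, fun h => Subtype.ext (funext fun p => h p.1 p.2)⟩

/-- Solutions of the total differential equation are the coordinates of parallel sections. -/
theorem exists_parallelSection_of_hasFDerivAt (hl : 1 ≤ l) (D : B.Connection)
    {t : LocalTriv E} (ht : t ∈ B.trivs) {W : Type*} [NormedAddCommGroup W] [NormedSpace ℝ W]
    {φ : OpenPartialHomeomorph M W} (hφ : X.IsCmIso 1 φ) {N : Opens M}
    (hNφ : (N : Set M) ⊆ φ.source) (hNt : N ≤ t.base)
    {Γ : W → (Fin t.rank → ℝ) →L[ℝ] W →L[ℝ] (Fin t.rank → ℝ)}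
    (hΓ : ContinuousOn Γ (φ.target ∩ φ.symm ⁻¹' N))
    (hiff : ∀ (U : Opens M) (s : B.sections 1 U) (p : M) (hU : p ∈ U), p ∈ N →
        ((D.toHom U s).1 ⟨p, hU⟩ = 0 ↔
          HasFDerivAt (t.coord s.1 ∘ φ.symm) (Γ (φ p) (t.coord s.1 p)) (φ p)))
    {U : Opens M} (hUN : U ≤ N) {u : W → (Fin t.rank → ℝ)}
    (hu : ∀ p ∈ U, HasFDerivAt u (Γ (φ p) (u (φ p))) (φ p)) :
    ∃ s ∈ D.parallelSections U, ∀ p ∈ U, t.coord s.1 p = u (φ p) := by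
  have hopen : IsOpen (φ.target ∩ φ.symm ⁻¹' U) := φ.symm.isOpen_inter_preimage U.isOpen
  have hu' : ∀ y ∈ φ.target ∩ φ.symm ⁻¹' U, HasFDerivAt u (Γ y (u y)) y := fun y hy => by
    have := hu _ hy.2
    rwa [φ.right_inv hy.1] at this
  have hC1 : ContDiffOn ℝ 1 u (φ.target ∩ φ.symm ⁻¹' U) := by
    have hdiff : DifferentiableOn ℝ u (φ.target ∩ φ.symm ⁻¹' U) := fun y hy =>
      (hu' y hy).differentiableAt.differentiableWithinAt
    rw [show (1 : WithTop ℕ∞) = 0 + 1 by simp, contDiffOn_succ_iff_fderiv_of_isOpen hopen]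
    refine ⟨hdiff, by simp, contDiffOn_zero.2 ?_⟩
    refine ContinuousOn.congr (f := fun y => Γ y (u y)) ?_ fun y hy => (hu' y hy).fderiv
    exact (hΓ.mono fun y hy => ⟨hy.1, hUN hy.2⟩).clm_apply hdiff.continuousOn
  have hc : ∀ i, X.CmOn 1 (fun q => u (φ q) i) U := by
    intro i e he
    have h1 := ((contDiffOn_pi.1 hC1) i).comp ((hφ e he).1.mono
      (fun y (hy : y ∈ e.2.target ∩ e.2.symm ⁻¹' U) => ⟨hy.1, hNφ (hUN hy.2)⟩)) ?_
    · exact h1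
    · intro y hy
      have hys : e.2.symm y ∈ φ.source := hNφ (hUN hy.2)
      refine ⟨φ.map_source hys, ?_⟩
      simp only [mem_preimage, Function.comp, φ.left_inv hys]
      exact hy.2
  let s := frameSum hl t ht (hUN.trans hNt) (fun q => u (φ q)) hc
  have hcoord : ∀ p ∈ U, t.coord s.1 p = u (φ p) := by
    intro p hp
    rw [t.coord_of_mem s.1 hp (hNt (hUN hp)), frameSum_apply]
    exact LinearEquiv.apply_symm_apply _ _
  refine ⟨s, D.mem_parallelSections_iff.2 fun p hp => (hiff U s p hp (hUN hp)).2 ?_, hcoord⟩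
  rw [hcoord p hp]
  refine (hu p hp).congr_of_eventuallyEq ?_
  have hps : p ∈ φ.source := hNφ (hUN hp)
  filter_upwards [hopen.mem_nhds ⟨φ.map_source hps, by rwa [mem_preimage, φ.left_inv hps]⟩]
    with y hy
  rw [Function.comp, hcoord _ hy.2, φ.right_inv hy.1]

end Connection

end ClVectorBundle

end Bundles

/-! ### Local extensions of parallel sections -/

section Bundles

variable {k : ℕ∞} {M : Type u} [TopologicalSpace M] {X : CkManifold k M} {l : ℕ∞}
  {E : M → Type w} [∀ p, AddCommGroup (E p)] [∀ p, Module ℝ (E p)]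

namespace ClVectorBundle

variable {B : ClVectorBundle X l E}

theorem continuousAt_coord {U : Opens M} (s : B.sections 1 U) {t : LocalTriv E} (ht : t ∈ B.trivs)
    {p : M} (hU : p ∈ U) (hb : p ∈ t.base) : ContinuousAt (t.coord s.1) p := by
  obtain ⟨e, he, hp⟩ := X.cover p
  have h1 : ContinuousAt (t.coord s.1 ∘ e.2.symm) (e.2 p) :=
    (CkManifold.CmOn.differentiableAt le_rfl (U.isOpen.inter t.base.isOpen) (s.2 t ht) ⟨hU, hb⟩
      ⟨e, he, hp⟩).continuousAt
  refine (h1.comp (e.2.continuousAt hp)).congr ?_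
  filter_upwards [e.2.open_source.mem_nhds hp] with q hq
  simp [e.2.left_inv hq]

/-- Two sections of class `C¹` that agree on a set agree at the points of its closure. -/
theorem sections_eq_of_mem_closure {U U' : Opens M} (s : B.sections 1 U) (s' : B.sections 1 U')
    {S : Set M} (h : ∀ q (hU : q ∈ U) (hU' : q ∈ U'), q ∈ S → s.1 ⟨q, hU⟩ = s'.1 ⟨q, hU'⟩)
    {p : M} (hU : p ∈ U) (hU' : p ∈ U') (hp : p ∈ closure S) : s.1 ⟨p, hU⟩ = s'.1 ⟨p, hU'⟩ := by
  obtain ⟨t, ht, hb⟩ := B.cover p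
  have : (𝓝[S] p).NeBot := mem_closure_iff_nhdsWithin_neBot.1 hp
  have h1 := (continuousAt_coord s ht hU hb).tendsto.mono_left (nhdsWithin_le_nhds (s := S))
  have h2 := (continuousAt_coord s' ht hU' hb).tendsto.mono_left (nhdsWithin_le_nhds (s := S))
  have h3 : t.coord s.1 =ᶠ[𝓝[S] p] t.coord s'.1 := by
    filter_upwards [self_mem_nhdsWithin, nhdsWithin_le_nhds (U.isOpen.mem_nhds hU),
      nhdsWithin_le_nhds (U'.isOpen.mem_nhds hU'),
      nhdsWithin_le_nhds (t.base.isOpen.mem_nhds hb)] with q hS hq hq' hqb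
    rw [t.coord_of_mem s.1 hq hqb, t.coord_of_mem s'.1 hq' hqb, h q hq hq' hS]
  have h4 := tendsto_nhds_unique (h1.congr' h3) h2
  rw [t.coord_of_mem s.1 hU hb, t.coord_of_mem s'.1 hU' hb] at h4
  exact (t.equiv ⟨p, hb⟩).injective h4

namespace Connection

/-- The section `s` over the complement of `F` extends to a parallel section near `p`. -/
def ExtendsAt (D : B.Connection) (F : Closeds M) (s : B.sections 1 F.compl) (p : M) : Prop :=
  ∃ U : Opens M, p ∈ U ∧ ∃ s' ∈ D.parallelSections U,
    ∀ (q : M) (hU : q ∈ U) (hF : q ∈ F.compl), s'.1 ⟨q, hU⟩ = s.1 ⟨q, hF⟩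

/-- Local extensions of a section over a dense open set are unique, so that they can be glued. -/
theorem exists_extension_of_forall_extendsAt (D : B.Connection) {F : Closeds M}
    {s : B.sections 1 F.compl} (hdense : Dense (F : Set M)ᶜ) (hext : ∀ p, D.ExtendsAt F s p) :
    ∃ s' ∈ D.parallelSections ⊤, B.restrict le_top s' = s := by
  choose U hpU σ hσ hσs using hext
  have hglue : ∀ p q (hq : q ∈ U p), (σ q).1 ⟨q, hpU q⟩ = (σ p).1 ⟨q, hq⟩ := fun p q hq =>
    sections_eq_of_mem_closure (σ q) (σ p) (S := (F : Set M)ᶜ)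
      (fun r h h' hr => (hσs q r h hr).trans (hσs p r h' hr).symm) (hpU q) hq (hdense q)
  let τ : B.sections 1 ⊤ := ⟨fun p => (σ p).1 ⟨p, hpU p⟩, by
    intro t ht e he
    refine contDiffOn_of_locally_contDiffOn fun y hy => ?_
    refine ⟨e.2.target ∩ e.2.symm ⁻¹' U (e.2.symm y),
      e.2.symm.isOpen_inter_preimage (U _).isOpen, ⟨hy.1, hpU _⟩, ?_⟩
    refine (((σ (e.2.symm y)).2 t ht e he).mono ?_).congr ?_
    · exact fun z hz => ⟨hz.1.1, hz.2.2, hz.1.2.2⟩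
    · rintro z ⟨⟨hz1, -, hz2⟩, -, hz3⟩
      change t.coord _ _ = t.coord _ _
      rw [t.coord_of_mem _ (show e.2.symm z ∈ (⊤ : Opens M) from trivial) hz2,
        t.coord_of_mem _ hz3 hz2]
      exact congrArg _ (hglue _ _ hz3)⟩
  have hτ : ∀ p, B.restrict le_top τ = σ p := fun p =>
    Subtype.ext (funext fun q => hglue p q.1 q.2)
  refine ⟨τ, D.mem_parallelSections_iff.2 fun p _ => ?_, ?_⟩
  · have h1 := D.map_restrict ⊤ (U p) le_top τ ⟨p, hpU p⟩
    rw [hτ p] at h1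
    exact h1.symm.trans (D.mem_parallelSections_iff.1 (hσ p) p (hpU p))
  · exact Subtype.ext (funext fun q => hσs q.1 q.1 (hpU _) q.2)

/-- If `F` lies in a hypersurface, then a parallel section over the complement of `F` that
extends at one point of the hypersurface extends at all nearby points. -/
theorem exists_ball_forall_extendsAt (hk : 1 ≤ k) (hl : 1 ≤ l) (D : B.Connection) {F : Closeds M}
    {s : B.sections 1 F.compl} (hs : s ∈ D.parallelSections F.compl)
    {W : Type*} [NormedAddCommGroup W] [NormedSpace ℝ W]
    {φ : OpenPartialHomeomorph M W} (hφ : X.IsCmIso 1 φ) {p₀ : M} (hp₀ : p₀ ∈ φ.source)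
    {f : W →L[ℝ] ℝ} (hf : f ≠ 0) (hFf : ∀ q ∈ F, q ∈ φ.source → f (φ q) = 0) :
    ∃ r > 0, ball (φ p₀) r ⊆ φ.target ∧ ∀ q ∈ φ.source, φ q ∈ ball (φ p₀) r → f (φ q) = 0 →
      (q ∈ F → D.ExtendsAt F s q) →
      ∀ q' ∈ φ.source, φ q' ∈ ball (φ p₀) r → D.ExtendsAt F s q' := by
  obtain ⟨t, ht, hb₀⟩ := B.cover p₀
  obtain ⟨N, hp₀N, hNφ, hNt, Γ, hΓ, hiff⟩ := exists_christoffel hk hl D ht hφ hp₀ hb₀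
  have hopen : IsOpen (φ.target ∩ φ.symm ⁻¹' N) := φ.symm.isOpen_inter_preimage N.isOpen
  have hmem₀ : φ p₀ ∈ φ.target ∩ φ.symm ⁻¹' N :=
    ⟨φ.map_source hp₀, by rwa [mem_preimage, φ.left_inv hp₀]⟩
  have hbd : ∀ᶠ y in 𝓝 (φ p₀), ‖Γ y‖ < ‖Γ (φ p₀)‖ + 1 :=
    ((continuous_norm.tendsto (Γ (φ p₀))).comp
      (hΓ.continuousAt (hopen.mem_nhds hmem₀))).eventually_lt_const (lt_add_one _)
  obtain ⟨r, hr, hball⟩ := Metric.eventually_nhds_iff_ball.1 (hbd.and (hopen.mem_nhds hmem₀))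
  have hsub : ball (φ p₀) r ⊆ φ.target ∩ φ.symm ⁻¹' N := fun y hy => (hball y hy).2
  refine ⟨r, hr, fun y hy => (hsub hy).1, fun q hq hqr hfq hqF => ?_⟩
  have hN : ∀ q ∈ φ.source, φ q ∈ ball (φ p₀) r → q ∈ N := fun q hq hqr => by
    have := (hsub hqr).2
    rwa [mem_preimage, φ.left_inv hq] at this
  have hcont : ∀ {V : Opens M} (s' : B.sections 1 V) (q : M), q ∈ V → q ∈ φ.source →
      φ q ∈ ball (φ p₀) r → Tendsto (t.coord s'.1 ∘ φ.symm) (𝓝 (φ q)) (𝓝 (t.coord s'.1 q)) := by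
    intro V s' q hV hq hqr
    have h1 : Tendsto φ.symm (𝓝 (φ q)) (𝓝 q) := by
      have := φ.symm.continuousAt (φ.map_source hq)
      rwa [ContinuousAt, φ.left_inv hq] at this
    exact (continuousAt_coord s' ht hV (hNt (hN q hq hqr))).tendsto.comp h1
  let u : W → Fin t.rank → ℝ := t.coord s.1 ∘ φ.symm
  have hu : ∀ y ∈ ball (φ p₀) r, f y ≠ 0 → HasFDerivAt u (Γ y (u y)) y := by
    intro y hy hfy
    have hyt := (hsub hy).1
    have hyF : φ.symm y ∈ F.compl := fun h => hfy (by
      simpa [φ.right_inv hyt] using hFf _ h (φ.map_target hyt))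
    have h1 := (hiff F.compl s (φ.symm y) hyF (hsub hy).2).1
      (D.mem_parallelSections_iff.1 hs _ hyF)
    rw [φ.right_inv hyt] at h1
    exact h1
  obtain ⟨v, hv⟩ : ∃ v, Tendsto u (𝓝[{y | f y ≠ 0}] (φ q)) (𝓝 v) := by
    by_cases hqF' : q ∈ F
    · obtain ⟨U, hqU, s', -, hs's⟩ := hqF hqF'
      refine ⟨t.coord s'.1 q, ((hcont s' q hqU hq hqr).mono_left nhdsWithin_le_nhds).congr' ?_⟩
      have hmemU : φ.target ∩ φ.symm ⁻¹' U ∈ 𝓝 (φ q) :=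
        (φ.symm.isOpen_inter_preimage U.isOpen).mem_nhds
          ⟨φ.map_source hq, by rwa [mem_preimage, φ.left_inv hq]⟩
      filter_upwards [self_mem_nhdsWithin, nhdsWithin_le_nhds (isOpen_ball.mem_nhds hqr),
        nhdsWithin_le_nhds hmemU] with y (hfy : f y ≠ 0) hy hyU
      have hyt := (hsub hy).1
      have hyF : φ.symm y ∈ F.compl := fun h => hfy (by
        simpa [φ.right_inv hyt] using hFf _ h (φ.map_target hyt))
      simp only [Function.comp, u]
      rw [t.coord_of_mem s.1 hyF (hNt (hsub hy).2), t.coord_of_mem s'.1 hyU.2 (hNt (hsub hy).2),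
        hs's _ hyU.2 hyF]
    · exact ⟨_, (hcont s q hqF' hq hqr).mono_left nhdsWithin_le_nhds⟩
  obtain ⟨u', hu'u, hu'⟩ := exists_extension_across_hyperplane (convex_ball (φ p₀) r) isOpen_ball
    isBounded_ball (hΓ.mono hsub) (fun y hy => (hball y hy).1.le) hf hu hqr hfq hv
  let U₀ : Opens M := ⟨φ.source ∩ φ ⁻¹' ball (φ p₀) r, φ.isOpen_inter_preimage isOpen_ball⟩
  obtain ⟨s', hs', hs'u⟩ := exists_parallelSection_of_hasFDerivAt hl D ht hφ hNφ hNt hΓ hiff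
    (U := U₀) (fun q hq => hN q hq.1 hq.2) (u := u') fun q hq => hu' _ hq.2
  refine fun q' hq' hq'r => ⟨U₀, ⟨hq', hq'r⟩, s', hs', fun x hxU hxF => ?_⟩
  have hxb : x ∈ t.base := hNt (hN x hxU.1 hxU.2)
  refine (t.equiv ⟨x, hxb⟩).injective ?_
  rw [← t.coord_of_mem s'.1 hxU hxb, ← t.coord_of_mem s.1 hxF hxb, hs'u x hxU]
  have : (𝓝[{y | f y ≠ 0}] (φ x)).NeBot :=
    mem_closure_iff_nhdsWithin_neBot.1 (f.dense_ne_zero hf _)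
  refine tendsto_nhds_unique
    ((hu' _ hxU.2).continuousAt.tendsto.mono_left (nhdsWithin_le_nhds (s := {y | f y ≠ 0})))
    (((hcont s x hxF hxU.1 hxU.2).mono_left nhdsWithin_le_nhds).congr' ?_)
  filter_upwards [self_mem_nhdsWithin, nhdsWithin_le_nhds (isOpen_ball.mem_nhds hxU.2)]
    with y hfy hy using (hu'u y hy hfy).symm

end Connection

end ClVectorBundle

end Bundles

/-! ### Submanifold charts -/

section Submanifolds

variable {k : ℕ∞} {M : Type u} [TopologicalSpace M] {X : CkManifold k M}

theorem mem_iff_of_image_eq {W : Type*} [TopologicalSpace W] {φ : OpenPartialHomeomorph M W}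
    {F : Set M} {S : Set W} (himg : φ '' (F ∩ φ.source) = S ∩ φ.target) {q : M}
    (hq : q ∈ φ.source) : q ∈ F ↔ φ q ∈ S := by
  constructor
  · intro h
    exact (himg ▸ mem_image_of_mem φ ⟨h, hq⟩ : φ q ∈ S ∩ φ.target).1
  · intro h
    obtain ⟨q', hq', heq⟩ : φ q ∈ φ '' (F ∩ φ.source) := himg ▸ ⟨h, φ.map_source hq⟩
    rw [← φ.injOn hq'.2 hq heq]
    exact hq'.1

/-- The codimension of a submanifold at a point is a local notion. -/
theorem CkManifold.HasCodimAt.congr {m : ℕ∞} {F F' O : Set M} {p : M} {c : ℕ}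
    (hF : X.HasCodimAt m F p c) (hO : IsOpen O) (hp : p ∈ O) (h : ∀ q ∈ O, q ∈ F ↔ q ∈ F') :
    X.HasCodimAt m F' p c := by
  obtain ⟨d, φ, hpφ, hφ, himg⟩ := hF
  refine ⟨d, φ.restrOpen O hO, ⟨hpφ, hp⟩, fun e he => ⟨?_, ?_⟩, ?_⟩
  · exact (hφ e he).1.mono fun y hy => ⟨hy.1, hy.2.1⟩
  · exact (hφ e he).2.mono fun y hy => ⟨hy.1.1, hy.2⟩
  · apply Subset.antisymm
    · rintro _ ⟨q, ⟨hqF, hqs, hqO⟩, rfl⟩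
      refine ⟨(mem_iff_of_image_eq himg hqs).1 ((h q hqO).2 hqF), ?_⟩
      exact (φ.restrOpen O hO).map_source ⟨hqs, hqO⟩
    · rintro y ⟨hy, hyt⟩
      have hs := (φ.restrOpen O hO).map_target hyt
      refine ⟨φ.symm y, ⟨(h _ hs.2).1 ((mem_iff_of_image_eq himg hs.1).2 ?_), hs⟩, ?_⟩
      · exact (φ.right_inv hyt.1).symm ▸ hy
      · exact φ.right_inv hyt.1

/-- A submanifold with boundary is locally Euclidean at the points that a submanifold chart takes
into the interior of the half-space. -/
theorem exists_euclidean_chart {F : Set M} {d c : ℕ}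
    {φ : OpenPartialHomeomorph M ((Fin d → ℝ) × (Fin c → ℝ))}
    (himg : φ '' (F ∩ φ.source) = (halfSpace d ×ˢ {0}) ∩ φ.target) {p : M} (hpF : p ∈ F)
    (hp : p ∈ φ.source) (hpos : ∀ i : Fin d, (i : ℕ) + 1 = d → 0 < (φ p).1 i) :
    ∃ e : OpenPartialHomeomorph F (EuclideanSpace ℝ (Fin d)), ⟨p, hpF⟩ ∈ e.source := by
  classical
  let P : Set (Fin d → ℝ) := {x | ∀ i : Fin d, (i : ℕ) + 1 = d → 0 < x i}
  have hP : IsOpen P := isOpen_pos_lastCoord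
  have hinj : ∀ x : Fin d → ℝ, x ∈ P → (x, (0 : Fin c → ℝ)) ∈ φ.target → φ.symm (x, 0) ∈ F := by
    intro x hx hxt
    refine (mem_iff_of_image_eq himg (φ.map_target hxt)).2 ?_
    rw [φ.right_inv hxt]
    exact ⟨fun i hi => (hx i hi).le, rfl⟩
  have hzero : ∀ x ∈ F, x ∈ φ.source → ((φ x).1, (0 : Fin c → ℝ)) = φ x := fun x hxF hxs =>
    Prod.ext rfl (((mem_iff_of_image_eq himg hxs).1 hxF).2 : (φ x).2 = 0).symm
  let e : OpenPartialHomeomorph F (Fin d → ℝ) :=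
    { toFun := fun x => (φ x).1
      invFun := fun x => if h : φ.symm (x, 0) ∈ F then ⟨φ.symm (x, 0), h⟩ else ⟨p, hpF⟩
      source := {x | (x : M) ∈ φ.source ∧ (φ x).1 ∈ P}
      target := {x | x ∈ P ∧ (x, (0 : Fin c → ℝ)) ∈ φ.target}
      map_source' := fun x hx => ⟨hx.2, by
        rw [hzero x x.2 hx.1]; exact φ.map_source hx.1⟩
      map_target' := fun x hx => by
        rw [dif_pos (hinj x hx.1 hx.2)]
        refine ⟨φ.map_target hx.2, ?_⟩
        rw [φ.right_inv hx.2]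
        exact hx.1
      left_inv' := fun x hx => by
        have h1 : φ.symm ((φ x).1, 0) = x := by rw [hzero x x.2 hx.1, φ.left_inv hx.1]
        refine Subtype.ext ?_
        rw [dif_pos (h1.symm ▸ x.2)]
        exact h1
      right_inv' := fun x hx => by
        rw [dif_pos (hinj x hx.1 hx.2)]
        simp only [φ.right_inv hx.2]
      open_source := by
        have h : ContinuousOn (fun x : F => (φ x).1) (Subtype.val ⁻¹' φ.source) :=
          continuous_fst.comp_continuousOn
            (φ.continuousOn.comp continuous_subtype_val.continuousOn (mapsTo_preimage _ _))
        exact h.isOpen_inter_preimage (φ.open_source.preimage continuous_subtype_val) hP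
      open_target := hP.inter (φ.open_target.preimage (by fun_prop))
      continuousOn_toFun := continuous_fst.comp_continuousOn (φ.continuousOn.comp
          continuous_subtype_val.continuousOn fun x hx => hx.1)
      continuousOn_invFun := by
        rw [IsInducing.subtypeVal.continuousOn_iff]
        refine ContinuousOn.congr (f := fun x => φ.symm (x, 0)) ?_ fun x hx => ?_
        · exact φ.symm.continuousOn.comp (by fun_prop) fun x hx => hx.2
        · simp only [Function.comp, dif_pos (hinj x hx.1 hx.2)] }
  refine ⟨e.transHomeomorph (EuclideanSpace.equiv (Fin d) ℝ).symm.toHomeomorph, ?_⟩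
  exact ⟨hp, hpos⟩

/-- The first normal coordinate in a submanifold chart of codimension `c + 1`. -/
def normalCoord (d c : ℕ) : (Fin d → ℝ) × (Fin (c + 1) → ℝ) →L[ℝ] ℝ :=
  (ContinuousLinearMap.proj 0).comp (ContinuousLinearMap.snd ℝ _ _)

theorem normalCoord_ne_zero (d c : ℕ) : normalCoord d c ≠ 0 := fun h => by
  have := DFunLike.congr_fun h (0, Pi.single 0 1)
  simp [normalCoord] at this

theorem CkManifold.HasCodimAt.mem_closure_compl {F : Set M} {p : M} {m : ℕ∞} {c : ℕ} (hc : 1 ≤ c)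
    (hF : X.HasCodimAt m F p c) : p ∈ closure Fᶜ := by
  obtain ⟨d, φ, hp, -, himg⟩ := hF
  obtain ⟨c, rfl⟩ := Nat.exists_eq_add_of_le' hc
  have h1 : φ p ∈ closure (φ.target ∩ {z | normalCoord d c z ≠ 0}) :=
    φ.open_target.inter_closure
      ⟨φ.map_source hp, (normalCoord d c).dense_ne_zero (normalCoord_ne_zero d c) _⟩
  have h2 := (φ.symm.continuousAt (φ.map_source hp)).continuousWithinAt.mem_closure_image h1
  rw [φ.left_inv hp] at h2
  refine closure_mono ?_ h2
  rintro _ ⟨y, ⟨hyt, hy⟩, rfl⟩ hyF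
  have h3 := (mem_iff_of_image_eq himg (φ.map_target hyt)).1 hyF
  rw [φ.right_inv hyt] at h3
  exact hy (congrFun (show y.2 = 0 from h3.2) 0)

theorem norm_piSingle_one_le {n : ℕ} (i : Fin n) : ‖(Pi.single i 1 : Fin n → ℝ)‖ ≤ 1 := by
  refine (pi_norm_le_iff_of_nonneg zero_le_one).2 fun j => ?_
  by_cases h : j = i <;> simp [h]

end Submanifolds

section Bundles

variable {k : ℕ∞} {M : Type u} [TopologicalSpace M] {X : CkManifold k M} {l : ℕ∞}
  {E : M → Type w} [∀ p, AddCommGroup (E p)] [∀ p, Module ℝ (E p)]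

namespace ClVectorBundle

variable {B : ClVectorBundle X l E}

namespace Connection

/-- If the section does not extend near `p ∈ F`, then it extends near no point of `F` close to `p`,
and `F` has codimension `1` and no boundary at `p`: otherwise the hypersurface given by the first
normal coordinate would contain points outside `F` arbitrarily close to `p`. -/
theorem exists_open_not_extendsAt (hk : 1 ≤ k) (hl : 1 ≤ l) (D : B.Connection)
    {F : Closeds M} {s : B.sections 1 F.compl} (hs : s ∈ D.parallelSections F.compl) {p : M}
    (hpF : p ∈ (F : Set M)) {c : ℕ} (hc : 1 ≤ c) (hF : X.HasCodimAt 1 (F : Set M) p c)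
    (hp : ¬ D.ExtendsAt F s p) :
    (∃ O : Set M, IsOpen O ∧ p ∈ O ∧ ∀ q ∈ O, q ∈ (F : Set M) → ¬ D.ExtendsAt F s q) ∧ c = 1 ∧
      ∃ (d : ℕ) (e : OpenPartialHomeomorph (F : Set M) (EuclideanSpace ℝ (Fin d))),
        ⟨p, hpF⟩ ∈ e.source := by
  obtain ⟨d, φ, hpφ, hφ, himg⟩ := hF
  obtain ⟨c, rfl⟩ := Nat.exists_eq_add_of_le' hc
  have hiff : ∀ q ∈ φ.source, q ∈ (F : Set M) ↔ φ q ∈ halfSpace d ×ˢ {0} := fun q hq =>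
    mem_iff_of_image_eq himg hq
  have hFf : ∀ q ∈ F, q ∈ φ.source → normalCoord d c (φ q) = 0 := fun q hqF hq =>
    congrFun (show (φ q).2 = 0 from ((hiff q hq).1 hqF).2) 0
  obtain ⟨r, hr, hrt, hball⟩ := exists_ball_forall_extendsAt hk hl D hs hφ hpφ
    (normalCoord_ne_zero d c) hFf
  have hpp : φ p ∈ halfSpace d ×ˢ {0} := (hiff p hpφ).1 hpF
  have hpb : φ p ∈ ball (φ p) r := mem_ball_self hr
  -- the points of the hyperplane near `φ p` all belong to the image of `F`
  have hall : ∀ z : (Fin d → ℝ) × (Fin (c + 1) → ℝ), ‖z‖ ≤ 1 → normalCoord d c z = 0 →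
      φ p + (r / 2) • z ∈ halfSpace d ×ˢ {0} := by
    intro z hz hz0
    have hzb : φ p + (r / 2) • z ∈ ball (φ p) r := by
      rw [mem_ball, dist_eq_norm, add_sub_cancel_left, norm_smul, Real.norm_eq_abs,
        abs_of_pos (half_pos hr)]
      nlinarith
    have hqs := φ.map_target (hrt hzb)
    have hq := φ.right_inv (hrt hzb)
    have h1 : normalCoord d c (φ p + (r / 2) • z) = 0 := by
      rw [map_add, map_smul, hz0, hFf p hpF hpφ, smul_zero, add_zero]
    by_contra hne
    refine hp (hball _ hqs (by rwa [hq]) (by rwa [hq]) (fun h => ?_) p hpφ hpb)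
    have := (hiff _ hqs).1 h
    rw [hq] at this
    exact absurd this hne
  refine ⟨⟨φ.source ∩ φ ⁻¹' ball (φ p) r, φ.isOpen_inter_preimage isOpen_ball, ⟨hpφ, hpb⟩,
    fun q hq hqF hqe => hp (hball q hq.1 hq.2 (hFf q hqF hq.1) (fun _ => hqe) p hpφ hpb)⟩, ?_, d,
    exists_euclidean_chart himg hpF hpφ fun i hi => ?_⟩
  · by_contra hc1
    have hc0 : 0 < c := by omega
    have h1 := (hall (0, Pi.single ⟨1, by omega⟩ 1) (by
      simpa [Prod.norm_def] using norm_piSingle_one_le _) ?_).2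
    · have h2 := congrFun (show (φ p).2 +
          (r / 2) • (Pi.single (⟨1, by omega⟩ : Fin (c + 1)) (1 : ℝ)) = 0 from h1) ⟨1, by omega⟩
      have h3 : (φ p).2 = 0 := hpp.2
      simp [h3, hr.ne'] at h2
    · simp [normalCoord, Fin.ext_iff]
  · by_contra hneg
    have h1 := (hall (-Pi.single i 1, 0) (by
      simpa [Prod.norm_def] using norm_piSingle_one_le i) (by simp [normalCoord])).1 i hi
    simp only [Prod.fst_add, Prod.smul_fst, Pi.add_apply, Pi.smul_apply, Pi.neg_apply,
      Pi.single_eq_same, smul_eq_mul] at h1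
    linarith

end Connection

end ClVectorBundle

end Bundles

/-! ### Negligibility -/

theorem mainTheorem1 {k : ℕ∞} (hk : 1 ≤ k) {M : Type u} [TopologicalSpace M]
    (X : CkManifold k M) (F : Closeds M)
    (hF : X.IsSubmanifoldWithBoundary 1 (F : Set M))
    (hcodim : 1 ≤ X.codim 1 (F : Set M))
    (hboundary : ∀ p : (F : Set M),
      X.codim 1 (Subtype.val '' connectedComponent p) = 1 →
        (connectedComponent p ∩ boundaryPoints (F : Set M)).Nonempty) :
    IsNegligibleForAllConnections.{u, w} X F := by
  intro l hl _ E _ _ B D s hs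
  have hpos : ∀ p ∈ (F : Set M), ∀ c : ℕ, X.HasCodimAt 1 (F : Set M) p c → 1 ≤ c := by
    intro p hp c hc
    have h : X.codim 1 (F : Set M) ≤ c := sInf_le ⟨p, hp, c, hc, rfl⟩
    exact_mod_cast hcodim.trans h
  have hdense : Dense (F : Set M)ᶜ := by
    intro p
    by_cases hp : p ∈ (F : Set M)
    · obtain ⟨c, hc⟩ := hF p hp
      exact CkManifold.HasCodimAt.mem_closure_compl (hpos p hp c hc) hc
    · exact subset_closure hp
  refine D.exists_extension_of_forall_extendsAt hdense fun p => ?_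
  by_cases hpF : p ∈ (F : Set M)
  swap
  · exact ⟨F.compl, hpF, s, hs, fun _ _ _ => rfl⟩
  by_contra hp
  let x₀ : (F : Set M) := ⟨p, hpF⟩
  -- the set of points of `F` at which the section extends is open and closed in `F`
  have hclopen : IsClopen {x : (F : Set M) | ¬ D.ExtendsAt F s x} := by
    constructor
    · refine ⟨isOpen_iff_mem_nhds.2 fun x hx => ?_⟩
      obtain ⟨U, hxU, h⟩ : D.ExtendsAt F s x := not_not.1 hx
      filter_upwards [(U.isOpen.preimage continuous_subtype_val).mem_nhds hxU] with y hy
      exact not_not.2 ⟨U, hy, h⟩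
    · refine isOpen_iff_mem_nhds.2 fun x hx => ?_
      obtain ⟨c, hc⟩ := hF x x.2
      obtain ⟨⟨O, hO, hxO, h⟩, -⟩ :=
        D.exists_open_not_extendsAt hk hl hs x.2 (hpos x x.2 c hc) hc hx
      filter_upwards [(hO.preimage continuous_subtype_val).mem_nhds hxO] with y hy
      exact h y hy y.2
  have hcomp : ∀ x ∈ connectedComponent x₀, ¬ D.ExtendsAt F s (x : M) := fun x hx =>
    isPreconnected_connectedComponent.subset_isClopen hclopen ⟨x₀, mem_connectedComponent, hp⟩ hx
  have heuclid : ∀ x ∈ connectedComponent x₀, X.HasCodimAt 1 (F : Set M) (x : M) 1 ∧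
      ∃ (d : ℕ) (e : OpenPartialHomeomorph (F : Set M) (EuclideanSpace ℝ (Fin d))),
        x ∈ e.source := by
    intro x hx
    obtain ⟨c, hc⟩ := hF x x.2
    obtain ⟨-, rfl, h⟩ :=
      D.exists_open_not_extendsAt hk hl hs x.2 (hpos x x.2 c hc) hc (hcomp x hx)
    exact ⟨hc, h⟩
  -- the component is open in `F`, so it has the same codimensions as `F`
  have hopen : ∀ x ∈ connectedComponent x₀, ∃ O : Set M, IsOpen O ∧ (x : M) ∈ O ∧
      ∀ q ∈ O, q ∈ (F : Set M) ↔ q ∈ Subtype.val '' connectedComponent x₀ := by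
    intro x hx
    obtain ⟨-, d, e, hxe⟩ := heuclid x hx
    have h1 := connectedComponent_mem_nhds_of_mem_source e hxe
    rw [← connectedComponent_eq hx] at h1
    obtain ⟨T, hT, hTsub⟩ := mem_nhds_subtype _ _ _ |>.1 h1
    obtain ⟨O, hOT, hO, hxO⟩ := mem_nhds_iff.1 hT
    refine ⟨O, hO, hxO, fun q hq => ⟨fun hqF => ⟨⟨q, hqF⟩, hTsub (hOT hq), rfl⟩, ?_⟩⟩
    rintro ⟨y, -, rfl⟩
    exact y.2
  have hone : X.codim 1 (Subtype.val '' connectedComponent x₀) = 1 := by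
    apply le_antisymm
    · obtain ⟨O, hO, hxO, h⟩ := hopen x₀ mem_connectedComponent
      exact sInf_le ⟨p, ⟨x₀, mem_connectedComponent, rfl⟩, 1,
        (heuclid x₀ mem_connectedComponent).1.congr hO hxO h, by simp⟩
    · refine le_sInf ?_
      rintro _ ⟨_, ⟨x, hx, rfl⟩, c, hc, rfl⟩
      obtain ⟨O, hO, hxO, h⟩ := hopen x hx
      exact_mod_cast hpos x x.2 c (hc.congr hO hxO fun q hq => (h q hq).symm)
  obtain ⟨x, hx, hxb⟩ := hboundary x₀ hone
  obtain ⟨-, d, e, hxe⟩ := heuclid x hx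
  exact notMem_boundaryPoints_of_mem_source e hxe hxb
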